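/- Let $d\ge 2$, $\alpha=\frac{2}{d-1}$, let $q\in\mathbb S^{d-1}$ be fixed and let $V\in\mathbb R^{d\times d}$. Let $x_1,x_2,\dots$ be i.i.d. random points of $\mathbb S^{d-1}$ with common law $\rho\,d\sigma$, where $\sigma$ is the (unnormalized) surface measure on $\mathbb S^{d-1}$ and the density $\rho\ge 0$ is $C^2$ on $\mathbb S^{d-1}$ with $\rho(q)>0$. For a real sequence $(\beta_n)$ put $$A_j=\frac{e^{\beta_n\langle q,x_j\rangle}}{\sum_{l=1}^n e^{\beta_n\langle q,x_l\rangle}}\quad(1\le j\le n),\qquad \mathsf{ATT}(n)=V\sum_{j=1}^n A_jx_j,\qquad \mathcal Y_n(q)=\mathsf{ATT}(n)-Vq,$$ and $$\mathcal Y(q)=\nabla_{\mathbb S^{d-1}}\log\rho(q)-\tfrac{d-1}{2}\,q,\qquad \Sigma(q)=\frac{c_d}{\rho(q)}\bigl(\mathrm{Id}-qq^{\top}\bigr),\qquad c_d=2^{-d}\pi^{-(d-1)/2},$$ where $\nabla_{\mathbb S^{d-1}}$ is the spherical gradient, regarded as a vector of $\mathbb R^d$ orthogonal to $q$. Assume that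 $\beta_n\to\infty$ and $\beta_n n^{-\alpha}\to0$ as $n\to\infty$. 1. If $\beta_n^{1+\alpha}n^{-\alpha}\to0$, then $\beta_n\mathcal Y_n(q)\to V\mathcal Y(q)$ in probability. 2. If $\beta_n^{1+\alpha}n^{-\alpha}\to\tau\in(0,\infty)$, then $\beta_n\mathcal Y_n(q)\to V\mathcal Y(q)+G_\tau$ in distribution, where $G_\tau\sim\mathcal N\bigl(0,\tau^{1/\alpha}V\Sigma(q)V^{\top}\bigr)$. 3. If $\beta_n^{1+\alpha}n^{-\alpha}\to\infty$, then $\sqrt{n\beta_n^{1-1/\alpha}}\;\mathcal Y_n(q)\to G_1$ in distribution, where $G_1\sim\mathcal N\bigl(0,V\Sigma(q)V^{\top}\bigr)$. Moreover, under the assumptions $\beta_n\to\infty$ and $\beta_nn^{-\alpha}\to0$ alone (hence in all three regimes), $\mathcal Y_n(q)\to0$ and $\mathsf{ATT}(n)\to Vq$ in probability. -/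

import Mathlib

open MeasureTheory ProbabilityTheory Filter Topology Manifold

noncomputable section

/-- The Euclidean space `ℝ^d`. -/
abbrev Euc (d : ℕ) : Type := EuclideanSpace ℝ (Fin d)

/-- The unit sphere `S^{d-1}` of `ℝ^d`. -/
abbrev USphere (d : ℕ) : Type := Metric.sphere (0 : Euc d) 1

/-- The (unnormalized) surface measure on `S^{d-1}`. -/
def surfaceMeasure (d : ℕ) : Measure (USphere d) :=
  (volume : Measure (Euc d)).toSphere

/-- The measure `ρ dσ` on `S^{d-1}`. -/
def keyLaw {d : ℕ} (ρ : USphere d → ℝ) : Measure (USphere d) :=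
  (surfaceMeasure d).withDensity fun x => ENNReal.ofReal (ρ x)

/-- The local exponent `α = 2 / (d - 1)`. -/
def alphaExp (d : ℕ) : ℝ := 2 / ((d : ℝ) - 1)

/-- Softmax attention weight of the key `x j` among the `n` keys `x 0, …, x (n - 1)`, for the
query `q` and the inverse temperature `β`. -/
def attnWeight {d : ℕ} (β : ℝ) (q : USphere d) (x : ℕ → USphere d) (n j : ℕ) : ℝ :=
  Real.exp (β * inner ℝ (q : Euc d) (x j : Euc d)) /
    ∑ l ∈ Finset.range n, Real.exp (β * inner ℝ (q : Euc d) (x l : Euc d))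

/-- The attention output `ATT(n) = V ∑_j A_j x_j`. -/
def attnOutput {d : ℕ} (β : ℝ) (V : Matrix (Fin d) (Fin d) ℝ) (q : USphere d)
    (x : ℕ → USphere d) (n : ℕ) : Euc d :=
  Matrix.toEuclideanCLM (𝕜 := ℝ) V
    (∑ j ∈ Finset.range n, attnWeight β q x n j • (x j : Euc d))

/-- The output displacement `ATT(n) - V q`. -/
def attnDisplacement {d : ℕ} (β : ℝ) (V : Matrix (Fin d) (Fin d) ℝ) (q : USphere d)
    (x : ℕ → USphere d) (n : ℕ) : Euc d :=
  attnOutput β V q x n - Matrix.toEuclideanCLM (𝕜 := ℝ) V (q : Euc d)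

/-- The extension of a function on the sphere to `ℝ^d ∖ {0}`, constant along rays
(with the value `0` at the origin). -/
def radialExtension {d : ℕ} (f : USphere d → ℝ) (x : Euc d) : ℝ :=
  if hx : x = 0 then 0
  else f ⟨‖x‖⁻¹ • x, by simp [norm_smul, inv_mul_cancel₀ (norm_ne_zero_iff.mpr hx)]⟩

/-- The spherical gradient at `q`, as a vector of `ℝ^d` (tangent to the sphere at `q`): the
Euclidean gradient at `q` of the extension that is constant along rays. -/
def sphericalGradient {d : ℕ} (f : USphere d → ℝ) (q : USphere d) : Euc d :=
  gradient (radialExtension f) (q : Euc d)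

/-- The drift `∇ log ρ(q) - ((d - 1) / 2) q`. -/
def attnDrift {d : ℕ} (ρ : USphere d → ℝ) (q : USphere d) : Euc d :=
  sphericalGradient (fun x => Real.log (ρ x)) q - (((d : ℝ) - 1) / 2) • (q : Euc d)

/-- The constant `c_d = 2^{-d} π^{-(d-1)/2}`. -/
def covConst (d : ℕ) : ℝ := (2 : ℝ) ^ (-(d : ℝ)) * Real.pi ^ (-((d : ℝ) - 1) / 2)

/-- The matrix `P_q = Id - q qᵀ` of the orthogonal projection onto the tangent space at `q`. -/
def tangentProj {d : ℕ} (q : USphere d) : Matrix (Fin d) (Fin d) ℝ :=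
  1 - Matrix.vecMulVec (fun i => (q : Euc d) i) (fun i => (q : Euc d) i)

/-- The covariance `Σ(q) = (c_d / ρ(q)) P_q`. -/
def attnCov {d : ℕ} (ρ : USphere d → ℝ) (q : USphere d) : Matrix (Fin d) (Fin d) ℝ :=
  (covConst d / ρ q) • tangentProj q

end

open scoped RealInnerProductSpace

/-! ### Polar coordinates and Gaussian integrals -/

/-! On the sphere `⟨q, x⟩ = 1 - ‖x - q‖² / 2`, so the softmax weights are Gaussian weights `w` of
width `s⁻¹`, `s = √β`, times a factor `e^β` that cancels. The displacement is therefore the ratio of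
`∑ w(x_j) V(x_j - q)` to `∑ w(x_j)` (`attnDisplacement_eq`), and both sums are row sums of a
triangular array, i.i.d. within each row.

The moments of `w` come from a Laplace method (`tendsto_pow_mul_integral_sphereWeight`): multiplying
by a radial Gaussian turns an integral over the sphere into one over the ambient space, where `y = q
+ u / s` and dominated convergence lead to a standard Gaussian. The first moment is delicate
(`tendsto_pow_mul_integral_inner_keyLaw`): its term of order `s⁻¹` cancels by symmetry about the
axis `ℝ q`. At order `s⁻²` the gradient of `ρ` and the curvature of the sphere remain, and these
make up the drift.

For uniformly small rows, the limits of `n` times the first and second moments determine the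
limiting characteristic function (`tendsto_charFun_sum_of_small`). This gives a Gaussian limit for
the numerator and a weak law for the denominator, once each is divided by `n E w`; Slutsky's theorem
combines them. With a scale `c`, the drift is governed by the limit of `c / β` and the covariance by
that of `c² s^m / (n β)`, where `m = d - 1`; the regimes are different choices of `c`. -/

theorem exists_radialExtension_eq {d : ℕ} {y : Euc d} (hy : y ≠ 0) :
    ∃ x : USphere d, (x : Euc d) = ‖y‖⁻¹ • y ∧
      ∀ f : USphere d → ℝ, radialExtension f y = f x :=
  ⟨⟨‖y‖⁻¹ • y, by simp [norm_smul, inv_mul_cancel₀ (norm_ne_zero_iff.mpr hy)]⟩, rfl,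
    fun f => by rw [radialExtension, dif_neg hy]⟩

theorem radialExtension_coe {d : ℕ} (f : USphere d → ℝ) (x : USphere d) :
    radialExtension f (x : Euc d) = f x := by
  have hx : ‖(x : Euc d)‖ = 1 := by simp
  obtain ⟨z, hz, h⟩ := exists_radialExtension_eq (d := d) (y := x) (by
    intro h0; simp [h0] at hx)
  rw [h]; congr 1; ext1; rw [hz, hx]; simp

/-- Integration in polar coordinates of the product of a radial function and a function that is
constant along rays. -/
theorem integral_norm_mul_radialExtension {m : ℕ} (f : USphere (m + 1) → ℝ) (g : ℝ → ℝ) :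
    ∫ y : Euc (m + 1), g ‖y‖ * radialExtension f y =
      (∫ x, f x ∂surfaceMeasure (m + 1)) * ∫ r in Set.Ioi (0 : ℝ), r ^ m * g r := by
  have hdim : Module.finrank ℝ (Euc (m + 1)) - 1 = m := by simp
  calc ∫ y : Euc (m + 1), g ‖y‖ * radialExtension f y
      = ∫ y : ({(0)}ᶜ : Set (Euc (m + 1))), g ‖y.1‖ * radialExtension f y.1
          ∂((volume : Measure (Euc (m + 1))).comap (↑)) := by
        rw [integral_subtype_comap (measurableSet_singleton _).compl
          fun y => g ‖y‖ * radialExtension f y, restrict_compl_singleton]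
    _ = ∫ z : USphere (m + 1) × Set.Ioi (0 : ℝ), f z.1 * g z.2
          ∂((volume : Measure (Euc (m + 1))).toSphere.prod (.volumeIoiPow m)) := by
        have key := (volume : Measure (Euc (m + 1))).measurePreserving_homeomorphUnitSphereProd.integral_comp
          (Homeomorph.measurableEmbedding _)
          (fun z : USphere (m + 1) × Set.Ioi (0 : ℝ) => f z.1 * g z.2)
        rw [hdim] at key
        rw [← key]
        refine integral_congr_ae (ae_of_all _ fun y => ?_)
        obtain ⟨x, hx, hf⟩ := exists_radialExtension_eq (d := m + 1) (y := y.1) y.2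
        simp only [hf, homeomorphUnitSphereProd_apply_snd_coe]
        rw [mul_comm]
        congr 2
        ext1
        rw [hx, homeomorphUnitSphereProd_apply_fst_coe]
    _ = (∫ x, f x ∂surfaceMeasure (m + 1)) *
          ∫ r : Set.Ioi (0 : ℝ), g r ∂(Measure.volumeIoiPow m) :=
        integral_prod_mul f fun r : Set.Ioi (0 : ℝ) => g r
    _ = _ := by
        congr 1
        simp only [Measure.volumeIoiPow, ENNReal.ofReal]
        rw [integral_withDensity_eq_integral_smul,
          integral_subtype_comap measurableSet_Ioi fun a => Real.toNNReal (a ^ m) • g a,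
          setIntegral_congr_fun measurableSet_Ioi fun x hx => ?_]
        · rw [NNReal.smul_def, Real.coe_toNNReal _ (pow_nonneg hx.out.le _), smul_eq_mul]
        · exact (measurable_subtype_coe.pow_const _).real_toNNReal

theorem integrable_exp_neg_mul_norm_sq {E : Type*} [NormedAddCommGroup E] [InnerProductSpace ℝ E]
    [FiniteDimensional ℝ E] [MeasurableSpace E] [BorelSpace E] {b : ℝ} (hb : 0 < b) :
    Integrable (fun v : E => Real.exp (-b * ‖v‖ ^ 2)) := by
  have h := (GaussianFourier.integrable_cexp_neg_mul_sq_norm_add (V := E) (b := b)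
    (by simpa using hb) 0 0).norm
  refine h.congr (ae_of_all _ fun v => ?_)
  simp only [Complex.norm_exp]
  congr 1
  simp [← Complex.ofReal_pow, ← Complex.ofReal_neg, ← Complex.ofReal_mul]

/-- Both sides are finite measures with the same characteristic function, by the Fourier transform
of the Gaussian. This is what allows Laplace limits to be evaluated through the covariance of
`stdGaussian`. -/
theorem withDensity_exp_eq_stdGaussian {d : ℕ} :
    (volume : Measure (Euc d)).withDensity
      (fun u => ENNReal.ofReal ((√(2 * Real.pi) ^ d)⁻¹ * Real.exp (-‖u‖ ^ 2 / 2))) =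
      stdGaussian (Euc d) := by
  have hpi : 0 < √(2 * Real.pi) ^ d := by positivity
  have hrpow : (2 * Real.pi) ^ ((d : ℝ) / 2) = √(2 * Real.pi) ^ d := by
    rw [Real.sqrt_eq_rpow, ← Real.rpow_natCast, ← Real.rpow_mul (by positivity)]
    congr 1; ring
  have hintegrable : Integrable (fun u : Euc d =>
      (√(2 * Real.pi) ^ d)⁻¹ * Real.exp (-‖u‖ ^ 2 / 2)) := by
    refine ((integrable_exp_neg_mul_norm_sq (E := Euc d) (b := 1 / 2)
      (by norm_num)).const_mul (√(2 * Real.pi) ^ d)⁻¹).congr (ae_of_all _ fun v => ?_)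
    simp only; congr 2; ring
  have : IsFiniteMeasure ((volume : Measure (Euc d)).withDensity
      (fun u => ENNReal.ofReal ((√(2 * Real.pi) ^ d)⁻¹ * Real.exp (-‖u‖ ^ 2 / 2)))) :=
    isFiniteMeasure_withDensity_ofReal hintegrable.2
  refine Measure.ext_of_charFun ?_
  ext t
  rw [charFun_stdGaussian, charFun_apply,
    integral_withDensity_eq_integral_toReal_smul (by fun_prop) (ae_of_all _ fun _ => by simp)]
  have key := GaussianFourier.integral_cexp_neg_mul_sq_norm_add (V := Euc d) (b := (1 / 2 : ℂ))
    (by norm_num) Complex.I t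
  have hleft : ∀ v : Euc d,
      (ENNReal.ofReal ((√(2 * Real.pi) ^ d)⁻¹ * Real.exp (-‖v‖ ^ 2 / 2))).toReal •
        Complex.exp (⟪v, t⟫ * Complex.I) =
      ((√(2 * Real.pi) ^ d : ℝ) : ℂ)⁻¹ *
        Complex.exp (-(1 / 2 : ℂ) * ‖v‖ ^ 2 + Complex.I * ⟪t, v⟫) := by
    intro v
    rw [ENNReal.toReal_ofReal (by positivity), Complex.exp_add, real_inner_comm,
      Complex.real_smul]
    push_cast
    rw [mul_comm Complex.I, mul_assoc]
    congr 3
    ring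
  simp_rw [hleft]
  rw [integral_const_mul, key, finrank_euclideanSpace, Fintype.card_fin]
  have h2 : ((Real.pi : ℂ) / (1 / 2)) ^ ((d : ℂ) / 2) = ((√(2 * Real.pi) ^ d : ℝ) : ℂ) := by
    rw [← hrpow, Complex.ofReal_cpow (by positivity)]
    push_cast
    congr 1
    ring
  rw [h2, ← mul_assoc, inv_mul_cancel₀ (by exact_mod_cast hpi.ne'), one_mul, Complex.I_sq]
  congr 1
  ring

theorem integral_mul_exp_neg_norm_sq {d : ℕ} (H : Euc d → ℝ) :
    ∫ u, H u * Real.exp (-‖u‖ ^ 2 / 2) = √(2 * Real.pi) ^ d * ∫ u, H u ∂stdGaussian (Euc d) := by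
  rw [← withDensity_exp_eq_stdGaussian,
    integral_withDensity_eq_integral_toReal_smul (by fun_prop) (ae_of_all _ fun _ => by simp),
    ← integral_const_mul]
  refine integral_congr_ae (ae_of_all _ fun u => ?_)
  have hpi : 0 < √(2 * Real.pi) ^ d := by positivity
  simp only
  rw [ENNReal.toReal_ofReal (by positivity), smul_eq_mul]
  field_simp

theorem integral_inner_mul_inner_stdGaussian {d : ℕ} (a b : Euc d) :
    ∫ u, ⟪a, u⟫ * ⟪b, u⟫ ∂stdGaussian (Euc d) = ⟪a, b⟫ := by
  have h : covarianceBilin (stdGaussian (Euc d)) a b = ⟪a, b⟫ :=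
    congrArg (fun B => B a b) (covarianceBilin_stdGaussian (E := Euc d))
  rw [← h, covarianceBilin_apply IsGaussian.memLp_two_id]
  simp

theorem integrable_inner_mul_inner_stdGaussian {d : ℕ} (a b : Euc d) :
    Integrable (fun u => ⟪a, u⟫ * ⟪b, u⟫) (stdGaussian (Euc d)) := by
  have h : ∀ c : Euc d, MemLp (fun u => ⟪c, u⟫) 2 (stdGaussian (Euc d)) := fun c =>
    (IsGaussian.memLp_two_id (μ := stdGaussian (Euc d))).const_inner c
  exact (h a).integrable_mul (h b)

theorem norm_sq_eq_sum_inner {d : ℕ} (u : Euc d) :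
    ‖u‖ ^ 2 = ∑ i, ⟪EuclideanSpace.basisFun (Fin d) ℝ i, u⟫ * ⟪EuclideanSpace.basisFun (Fin d) ℝ i, u⟫ := by
  rw [← real_inner_self_eq_norm_sq,
    ← (EuclideanSpace.basisFun (Fin d) ℝ).sum_inner_mul_inner u u]
  refine Finset.sum_congr rfl fun i _ => ?_
  rw [real_inner_comm]

theorem integral_norm_sq_stdGaussian {d : ℕ} :
    ∫ u, ‖u‖ ^ 2 ∂stdGaussian (Euc d) = d := by
  simp_rw [norm_sq_eq_sum_inner]
  rw [integral_finsetSum _ fun i _ => integrable_inner_mul_inner_stdGaussian _ _]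
  simp_rw [integral_inner_mul_inner_stdGaussian]
  simp

theorem integrable_norm_sq_stdGaussian {d : ℕ} :
    Integrable (fun u => ‖u‖ ^ 2) (stdGaussian (Euc d)) := by
  simp_rw [norm_sq_eq_sum_inner]
  exact integrable_finsetSum _ fun i _ => integrable_inner_mul_inner_stdGaussian _ _

/-- Substitute `r = 1 + v / s`; the Jacobian factor `r ^ m` tends to `1`. This is the mass of the
auxiliary radial factor, to be divided out in the Laplace method. -/
theorem tendsto_mul_integral_pow_mul_exp (m : ℕ) :
    Tendsto (fun s : ℝ => s * ∫ r in Set.Ioi (0 : ℝ), r ^ m * Real.exp (-(s * (r - 1)) ^ 2 / 2))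
      atTop (𝓝 √(2 * Real.pi)) := by
  set F : ℝ → ℝ → ℝ := fun s v =>
    (Set.Ioi (0 : ℝ)).indicator (fun r => r ^ m * Real.exp (-(s * (r - 1)) ^ 2 / 2)) (1 + s⁻¹ * v)
    with hF
  have hlim : ∫ v : ℝ, Real.exp (-v ^ 2 / 2) = √(2 * Real.pi) := by
    have := integral_gaussian (1 / 2)
    rw [show Real.pi / (1 / 2) = 2 * Real.pi by ring] at this
    rw [← this]
    congr 1; ext v; congr 1; ring
  rw [← hlim]
  have hrew : ∀ᶠ s : ℝ in atTop, ∫ v, F s v =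
      s * ∫ r in Set.Ioi (0 : ℝ), r ^ m * Real.exp (-(s * (r - 1)) ^ 2 / 2) := by
    filter_upwards [eventually_gt_atTop 0] with s hs
    rw [← integral_indicator measurableSet_Ioi]
    have h1 := Measure.integral_comp_mul_left (fun v => (Set.Ioi (0 : ℝ)).indicator
      (fun r => r ^ m * Real.exp (-(s * (r - 1)) ^ 2 / 2)) (1 + v)) s⁻¹
    rw [inv_inv, abs_of_pos hs, smul_eq_mul] at h1
    rw [hF]; simp only
    rw [h1, integral_add_left_eq_self]
  refine Tendsto.congr' hrew ?_
  -- For `s ≥ 1` the polynomial factor is at most `exp (m |v|)`, and `m |v| - v² / 2 ≤ m² - v² / 4`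
  -- because `(m - |v| / 2)² ≥ 0`.
  refine tendsto_integral_filter_of_dominated_convergence
    (fun v => Real.exp (m ^ 2) * Real.exp (-(1 / 4) * v ^ 2)) ?_ ?_ ?_ ?_
  · refine Eventually.of_forall fun s => Measurable.aestronglyMeasurable ?_
    exact (Measurable.indicator (by fun_prop) measurableSet_Ioi).comp (by fun_prop)
  · filter_upwards [eventually_ge_atTop 1] with s hs
    refine ae_of_all _ fun v => ?_
    have hs0 : 0 < s := by linarith
    by_cases hv : 1 + s⁻¹ * v ∈ Set.Ioi (0 : ℝ)
    · simp only [hF, Set.indicator_of_mem hv]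
      have hv' : 0 < 1 + s⁻¹ * v := hv
      rw [Real.norm_of_nonneg (by positivity), ← Real.exp_add,
        show s * (1 + s⁻¹ * v - 1) = v by field_simp; ring]
      have h1 : (1 + s⁻¹ * v) ^ m ≤ Real.exp (m * |v|) := by
        rw [Real.exp_nat_mul]
        gcongr
        have : s⁻¹ * v ≤ |v| := by
          calc s⁻¹ * v ≤ s⁻¹ * |v| := by gcongr; exact le_abs_self v
            _ ≤ 1 * |v| := by gcongr; exact inv_le_one_of_one_le₀ hs
            _ = |v| := one_mul _
        linarith [Real.add_one_le_exp |v|]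
      calc (1 + s⁻¹ * v) ^ m * Real.exp (-v ^ 2 / 2)
          ≤ Real.exp (m * |v|) * Real.exp (-v ^ 2 / 2) := by gcongr
        _ = Real.exp (m * |v| + -v ^ 2 / 2) := (Real.exp_add _ _).symm
        _ ≤ _ := by
          refine Real.exp_le_exp.mpr ?_
          nlinarith [sq_nonneg ((m : ℝ) - |v| / 2), sq_abs v]
    · simp only [hF, Set.indicator_of_notMem hv, norm_zero]
      positivity
  · exact (integrable_exp_neg_mul_sq (by norm_num)).const_mul _
  · refine ae_of_all _ fun v => ?_
    have h1 : Tendsto (fun s : ℝ => 1 + s⁻¹ * v) atTop (𝓝 1) := by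
      simpa using (tendsto_inv_atTop_zero.mul_const v).const_add 1
    have h2 : Tendsto (fun s : ℝ => (1 + s⁻¹ * v) ^ m * Real.exp (-v ^ 2 / 2)) atTop
        (𝓝 (Real.exp (-v ^ 2 / 2))) := by
      simpa using (h1.pow m).mul_const (Real.exp (-v ^ 2 / 2))
    refine h2.congr' ?_
    filter_upwards [h1.eventually (lt_mem_nhds one_pos), eventually_gt_atTop 0] with s hs hs0
    simp only [hF]
    rw [Set.indicator_of_mem (by exact hs), show s * (1 + s⁻¹ * v - 1) = v by field_simp; ring]

/-! ### Laplace asymptotics on the sphere -/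

/-- The Gaussian weight `exp (-(s ‖x - q‖)² / 2)` on the sphere, centred at `q`, of width `s⁻¹`. -/
noncomputable def sphereWeight {d : ℕ} (q : USphere d) (s : ℝ) (x : USphere d) : ℝ :=
  Real.exp (-(s * ‖(x : Euc d) - q‖) ^ 2 / 2)

theorem norm_usphere {d : ℕ} (x : USphere d) : ‖(x : Euc d)‖ = 1 := by simp

theorem sphereWeight_pos {d : ℕ} (q : USphere d) (s : ℝ) (x : USphere d) :
    0 < sphereWeight q s x := Real.exp_pos _

theorem sphereWeight_le_one {d : ℕ} (q : USphere d) (s : ℝ) (x : USphere d) :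
    sphereWeight q s x ≤ 1 := by
  refine Real.exp_le_one_iff.mpr ?_
  nlinarith [sq_nonneg (s * ‖(x : Euc d) - q‖)]

theorem continuous_sphereWeight {d : ℕ} (q : USphere d) (s : ℝ) :
    Continuous (sphereWeight q s) := by
  unfold sphereWeight; fun_prop

theorem measurable_radialExtension {d : ℕ} {f : USphere d → ℝ} (hf : Measurable f) :
    Measurable (radialExtension f) := by
  refine measurable_of_measurable_on_compl_singleton 0 ?_
  have h : Measurable fun y : {y : Euc d | y ≠ 0} => f ⟨‖(y : Euc d)‖⁻¹ • (y : Euc d), by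
      simp [norm_smul, inv_mul_cancel₀ (norm_ne_zero_iff.mpr y.2)]⟩ :=
    hf.comp (Measurable.subtype_mk (by fun_prop))
  convert h using 1
  ext y
  exact dif_neg y.2

theorem norm_inv_smul_sub_self {E : Type*} [NormedAddCommGroup E] [NormedSpace ℝ E] {y : E}
    (hy : y ≠ 0) : ‖‖y‖⁻¹ • y - y‖ = |‖y‖ - 1| := by
  have hn : ‖y‖ ≠ 0 := norm_ne_zero_iff.mpr hy
  have : ‖y‖⁻¹ • y - y = (‖y‖⁻¹ - 1) • y := by rw [sub_smul, one_smul]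
  rw [this, norm_smul, Real.norm_eq_abs, ← abs_of_nonneg (norm_nonneg y), ← abs_mul, abs_norm,
    sub_mul, inv_mul_cancel₀ hn, one_mul, abs_sub_comm]

theorem norm_inv_smul_sub_le {d : ℕ} (q : USphere d) {y : Euc d} (hy : y ≠ 0) :
    ‖‖y‖⁻¹ • y - q‖ ≤ 2 * ‖y - q‖ := by
  have h1 := norm_inv_smul_sub_self hy
  have h2 : |‖y‖ - 1| ≤ ‖y - q‖ := by
    simpa using abs_norm_sub_norm_le y (q : Euc d)
  calc ‖‖y‖⁻¹ • y - q‖ = ‖(‖y‖⁻¹ • y - y) + (y - q)‖ := by congr 1; abel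
    _ ≤ ‖‖y‖⁻¹ • y - y‖ + ‖y - q‖ := norm_add_le _ _
    _ ≤ _ := by linarith

/-- The triangle inequality through the normalised point, then `(a + b)² ≤ 2 (a² + b²)`. Hence the
angular and radial Gaussian factors together dominate a Gaussian in `y - q`. -/
theorem norm_sub_sq_le_polar {d : ℕ} (q : USphere d) {y : Euc d} (hy : y ≠ 0) :
    ‖y - q‖ ^ 2 ≤ 2 * (‖‖y‖⁻¹ • y - q‖ ^ 2 + (‖y‖ - 1) ^ 2) := by
  have h1 := norm_inv_smul_sub_self hy
  have h3 : ‖y - q‖ ≤ ‖‖y‖⁻¹ • y - q‖ + |‖y‖ - 1| := by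
    rw [← h1]
    calc ‖y - q‖ = ‖(‖y‖⁻¹ • y - q) - (‖y‖⁻¹ • y - y)‖ := by congr 1; abel
      _ ≤ _ := norm_sub_le _ _
  have h4 := sq_abs (‖y‖ - 1)
  nlinarith [norm_nonneg (y - q), sq_nonneg (‖‖y‖⁻¹ • y - q‖ - |‖y‖ - 1|),
    norm_nonneg (‖y‖⁻¹ • y - q), abs_nonneg (‖y‖ - 1)]

theorem tendsto_add_inv_smul {d : ℕ} (q u : Euc d) :
    Tendsto (fun s : ℝ => q + s⁻¹ • u) atTop (𝓝 q) := by
  simpa using ((tendsto_inv_atTop_zero (𝕜 := ℝ)).smul_const u).const_add q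

theorem eventually_add_inv_smul_ne_zero {d : ℕ} (q : USphere d) (u : Euc d) :
    ∀ᶠ s : ℝ in atTop, (q : Euc d) + s⁻¹ • u ≠ 0 :=
  (tendsto_add_inv_smul (q : Euc d) u).eventually_ne (fun h => by
    have := norm_usphere q
    simp [h] at this)

/-- The derivative of the norm at a unit vector, obtained by multiplying `‖y‖ - 1` by its conjugate
`‖y‖ + 1`. -/
theorem tendsto_mul_norm_sub_one {d : ℕ} (q : USphere d) (u : Euc d) :
    Tendsto (fun s : ℝ => s * (‖(q : Euc d) + s⁻¹ • u‖ - 1)) atTop (𝓝 ⟪(q : Euc d), u⟫) := by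
  have hq := norm_usphere q
  have h1 : Tendsto (fun s : ℝ => (2 * ⟪(q : Euc d), u⟫ + s⁻¹ * ‖u‖ ^ 2) /
      (‖(q : Euc d) + s⁻¹ • u‖ + 1)) atTop (𝓝 ((2 * ⟪(q : Euc d), u⟫ + 0 * ‖u‖ ^ 2) / (1 + 1))) := by
    refine Tendsto.div ?_ ?_ (by norm_num)
    · exact (tendsto_inv_atTop_zero.mul_const _).const_add _
    · have := (tendsto_add_inv_smul (q : Euc d) u).norm
      rw [hq] at this
      exact this.add_const 1
  have h2 : (2 * ⟪(q : Euc d), u⟫ + 0 * ‖u‖ ^ 2) / (1 + 1) = ⟪(q : Euc d), u⟫ := by ring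
  rw [h2] at h1
  refine h1.congr' ?_
  filter_upwards [eventually_gt_atTop 0] with s hs
  have h3 : ‖(q : Euc d) + s⁻¹ • u‖ ^ 2 = 1 + 2 * (s⁻¹ * ⟪(q : Euc d), u⟫) + s⁻¹ ^ 2 * ‖u‖ ^ 2 := by
    rw [norm_add_sq_real, hq, real_inner_smul_right, norm_smul, mul_pow, Real.norm_eq_abs, sq_abs]
    ring
  have h4 : 0 < ‖(q : Euc d) + s⁻¹ • u‖ + 1 := by positivity
  rw [div_eq_iff h4.ne', mul_assoc,
    show (‖(q : Euc d) + s⁻¹ • u‖ - 1) * (‖(q : Euc d) + s⁻¹ • u‖ + 1) =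
      ‖(q : Euc d) + s⁻¹ • u‖ ^ 2 - 1 by ring, h3]
  field_simp
  ring

/-- The derivative at `q` of the radial projection is the orthogonal projection onto the tangent
space. -/
theorem tendsto_smul_normalize_sub {d : ℕ} (q : USphere d) (u : Euc d) :
    Tendsto (fun s : ℝ => s • (‖(q : Euc d) + s⁻¹ • u‖⁻¹ • ((q : Euc d) + s⁻¹ • u) - q)) atTop
      (𝓝 (u - ⟪(q : Euc d), u⟫ • (q : Euc d))) := by
  have hq := norm_usphere q
  have h1 : Tendsto (fun s : ℝ => ‖(q : Euc d) + s⁻¹ • u‖⁻¹ •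
      (u - (s * (‖(q : Euc d) + s⁻¹ • u‖ - 1)) • (q : Euc d))) atTop
      (𝓝 ((1 : ℝ)⁻¹ • (u - ⟪(q : Euc d), u⟫ • (q : Euc d)))) := by
    refine Tendsto.smul ?_ ?_
    · have := (tendsto_add_inv_smul (q : Euc d) u).norm
      rw [hq] at this
      exact this.inv₀ one_ne_zero
    · exact ((tendsto_mul_norm_sub_one q u).smul_const _).const_sub _
  rw [inv_one, one_smul] at h1
  refine h1.congr' ?_
  filter_upwards [eventually_gt_atTop 0, eventually_add_inv_smul_ne_zero q u] with s hs hy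
  have hn : ‖(q : Euc d) + s⁻¹ • u‖ ≠ 0 := norm_ne_zero_iff.mpr hy
  set N := ‖(q : Euc d) + s⁻¹ • u‖
  have : u = s • (s⁻¹ • u) := by rw [smul_smul, mul_inv_cancel₀ hs.ne', one_smul]
  match_scalars <;> field_simp
  ring

theorem norm_sub_inner_smul_sq {d : ℕ} (q : USphere d) (u : Euc d) :
    ‖u - ⟪(q : Euc d), u⟫ • (q : Euc d)‖ ^ 2 = ‖u‖ ^ 2 - ⟪(q : Euc d), u⟫ ^ 2 := by
  rw [norm_sub_sq_real, norm_smul, norm_usphere, real_inner_smul_right, real_inner_comm,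
    Real.norm_eq_abs, mul_one, sq_abs]
  ring

/-- The Laplace method on the sphere. -/
theorem tendsto_pow_mul_integral_sphereWeight {m : ℕ} (q : USphere (m + 1))
    (h : ℝ → USphere (m + 1) → ℝ) (H : Euc (m + 1) → ℝ) (C : ℝ)
    (hmeas : ∀ s, Measurable (h s))
    (hbound : ∀ s x, |h s x| ≤ C * (1 + (s * ‖(x : Euc (m + 1)) - q‖) ^ 2))
    (hlim : ∀ u, Tendsto (fun s : ℝ => radialExtension (h s) ((q : Euc (m + 1)) + s⁻¹ • u)) atTop
      (𝓝 (H u))) :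
    Tendsto (fun s : ℝ => s ^ m * ∫ x, sphereWeight q s x * h s x ∂surfaceMeasure (m + 1)) atTop
      (𝓝 (√(2 * Real.pi) ^ m * ∫ u, H u ∂stdGaussian (Euc (m + 1)))) := by
  have hpi : 0 < √(2 * Real.pi) := by positivity
  have hC : 0 ≤ C := by
    have := hbound 0 q
    simp only [zero_mul] at this
    linarith [abs_nonneg (h 0 q)]
  set N : ℝ → ℝ := fun s => s * ∫ r in Set.Ioi (0 : ℝ), r ^ m * Real.exp (-(s * (r - 1)) ^ 2 / 2)
    with hN
  have hNlim : Tendsto N atTop (𝓝 √(2 * Real.pi)) := tendsto_mul_integral_pow_mul_exp m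
  -- The radial factor supplies the Gaussian decay in the direction `q` that the weight on the
  -- sphere lacks. The substitution `y = q + u / s` produces `s ^ (m + 1)`; dividing by `N s`, which
  -- carries one factor `s`, leaves `s ^ m`.
  set G : ℝ → Euc (m + 1) → ℝ := fun s y =>
    Real.exp (-(s * (‖y‖ - 1)) ^ 2 / 2) * radialExtension (fun x => sphereWeight q s x * h s x) y
    with hG
  have hGmeas : ∀ s, Measurable (G s) := fun s =>
    Measurable.mul (by fun_prop)
      (measurable_radialExtension ((continuous_sphereWeight q s).measurable.mul (hmeas s)))
  have hrew : ∀ᶠ s : ℝ in atTop, (∫ u, G s ((q : Euc (m + 1)) + s⁻¹ • u)) / N s =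
      s ^ m * ∫ x, sphereWeight q s x * h s x ∂surfaceMeasure (m + 1) := by
    filter_upwards [eventually_gt_atTop 0, hNlim.eventually_ne hpi.ne'] with s hs hNs
    rw [div_eq_iff hNs]
    have h1 := Measure.integral_comp_smul (volume : Measure (Euc (m + 1)))
      (fun u => G s ((q : Euc (m + 1)) + u)) s⁻¹
    rw [h1, integral_add_left_eq_self,
      integral_norm_mul_radialExtension (fun x => sphereWeight q s x * h s x)
        (fun r => Real.exp (-(s * (r - 1)) ^ 2 / 2)),
      finrank_euclideanSpace, Fintype.card_fin, abs_of_pos (by positivity), smul_eq_mul, hN]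
    simp only
    rw [inv_pow, inv_inv]
    ring
  have htarget : √(2 * Real.pi) ^ m * ∫ u, H u ∂stdGaussian (Euc (m + 1)) =
      (∫ u, H u * Real.exp (-‖u‖ ^ 2 / 2)) / √(2 * Real.pi) := by
    rw [integral_mul_exp_neg_norm_sq, pow_succ]
    field_simp
  rw [htarget]
  refine Tendsto.congr' hrew (Tendsto.div ?_ hNlim hpi.ne')
  -- The two exponentials give at most `exp (-‖u‖² / 4)`. Since `s ‖x - q‖ ≤ 2 ‖u‖`, the factor `h`
  -- costs `C (1 + 4 ‖u‖²) ≤ 33 C exp (‖u‖² / 8)`, which leaves the rate `1 / 8`.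
  refine tendsto_integral_filter_of_dominated_convergence
    (fun u => 33 * C * Real.exp (-(1 / 8) * ‖u‖ ^ 2)) ?_ ?_ ?_ ?_
  · exact Eventually.of_forall fun s => ((hGmeas s).comp (by fun_prop)).aestronglyMeasurable
  · filter_upwards [eventually_gt_atTop 0] with s hs
    refine ae_of_all _ fun u => ?_
    set y := (q : Euc (m + 1)) + s⁻¹ • u with hy
    have hyq : ‖y - q‖ = s⁻¹ * ‖u‖ := by
      rw [hy, add_sub_cancel_left, norm_smul, Real.norm_of_nonneg (by positivity)]
    by_cases hy0 : y = 0
    · simp only [hG, hy0, radialExtension, dif_pos, mul_zero, norm_zero]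
      positivity
    obtain ⟨x, hx, hf⟩ := exists_radialExtension_eq hy0
    simp only [hG, hf, sphereWeight, norm_mul, Real.norm_eq_abs, Real.abs_exp]
    rw [← mul_assoc, ← Real.exp_add]
    have e1 := norm_sub_sq_le_polar q hy0
    have e2 := norm_inv_smul_sub_le q hy0
    rw [← hx, hyq] at e1 e2
    have e3 : s * ‖(x : Euc (m + 1)) - q‖ ≤ 2 * ‖u‖ := by
      calc s * ‖(x : Euc (m + 1)) - q‖ ≤ s * (2 * (s⁻¹ * ‖u‖)) := by gcongr
        _ = 2 * ‖u‖ := by field_simp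
    have e4 : ‖u‖ ^ 2 ≤ 2 * ((s * ‖(x : Euc (m + 1)) - q‖) ^ 2 + (s * (‖y‖ - 1)) ^ 2) := by
      calc ‖u‖ ^ 2 = s ^ 2 * (s⁻¹ * ‖u‖) ^ 2 := by field_simp
        _ ≤ s ^ 2 * (2 * (‖(x : Euc (m + 1)) - q‖ ^ 2 + (‖y‖ - 1) ^ 2)) := by gcongr
        _ = _ := by ring
    have e5 : |h s x| ≤ C * (33 * Real.exp (‖u‖ ^ 2 / 8)) := by
      refine (hbound s x).trans ?_
      gcongr
      have : (s * ‖(x : Euc (m + 1)) - q‖) ^ 2 ≤ (2 * ‖u‖) ^ 2 := by gcongr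
      nlinarith [Real.add_one_le_exp (‖u‖ ^ 2 / 8), sq_nonneg ‖u‖]
    calc Real.exp (-(s * (‖y‖ - 1)) ^ 2 / 2 + -(s * ‖(x : Euc (m + 1)) - q‖) ^ 2 / 2) * |h s x|
        ≤ Real.exp (-‖u‖ ^ 2 / 4) * (C * (33 * Real.exp (‖u‖ ^ 2 / 8))) := by
          gcongr
          linarith
      _ = 33 * C * Real.exp (-‖u‖ ^ 2 / 4 + ‖u‖ ^ 2 / 8) := by rw [Real.exp_add]; ring
      _ = _ := by congr 2; ring
  · exact (integrable_exp_neg_mul_norm_sq (by norm_num)).const_mul _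
  · refine ae_of_all _ fun u => ?_
    have l1 := tendsto_mul_norm_sub_one q u
    have l2 := (tendsto_smul_normalize_sub q u).norm
    have l3 : Tendsto (fun s : ℝ => radialExtension (h s) ((q : Euc (m + 1)) + s⁻¹ • u) *
        Real.exp (-((s * (‖(q : Euc (m + 1)) + s⁻¹ • u‖ - 1)) ^ 2 +
          ‖s • (‖(q : Euc (m + 1)) + s⁻¹ • u‖⁻¹ • ((q : Euc (m + 1)) + s⁻¹ • u) - q)‖ ^ 2) / 2))
        atTop (𝓝 (H u * Real.exp (-(⟪(q : Euc (m + 1)), u⟫ ^ 2 +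
          ‖u - ⟪(q : Euc (m + 1)), u⟫ • (q : Euc (m + 1))‖ ^ 2) / 2))) :=
      (hlim u).mul ((Real.continuous_exp.tendsto _).comp
        ((((l1.pow 2).add (l2.pow 2)).neg).div_const 2))
    -- By Pythagoras the radial and tangential exponents add up to `‖u‖²`.
    rw [norm_sub_inner_smul_sq, add_sub_cancel] at l3
    refine l3.congr' ?_
    filter_upwards [eventually_gt_atTop 0, eventually_add_inv_smul_ne_zero q u] with s hs hy
    obtain ⟨x, hx, hf⟩ := exists_radialExtension_eq hy
    simp only [hG, hf, sphereWeight]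
    rw [← hx, norm_smul, Real.norm_of_nonneg hs.le, ← mul_assoc, ← Real.exp_add, mul_comm]
    congr 2
    ring

/-- The first moment of the weight on the sphere is radial. -/
theorem integral_sphereWeight_mul_inner_sub {m : ℕ} (q : USphere (m + 1)) (t : Euc (m + 1))
    (s : ℝ) (hs : 0 < ∫ r in Set.Ioi (0 : ℝ), r ^ m * Real.exp (-(s * (r - 1)) ^ 2 / 2)) :
    ∫ x, sphereWeight q s x * ⟪t, (x : Euc (m + 1)) - q⟫ ∂surfaceMeasure (m + 1) =
      ∫ x, sphereWeight q s x * (-⟪t, (q : Euc (m + 1))⟫ * (‖(x : Euc (m + 1)) - q‖ ^ 2 / 2))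
        ∂surfaceMeasure (m + 1) := by
  have hfin : IsFiniteMeasure (surfaceMeasure (m + 1)) := by
    unfold surfaceMeasure; infer_instance
  have hintegrable : ∀ f : USphere (m + 1) → ℝ, Continuous f → Integrable f (surfaceMeasure (m + 1)) :=
    fun f hf => hf.integrable_of_hasCompactSupport (HasCompactSupport.of_compactSpace f)
  have hq := norm_usphere q
  -- As `‖x - q‖² / 2 = 1 - ⟨q, x⟩` on the sphere, the bracket is `⟨t, x - ⟨q, x⟩ q⟩`, the pairing
  -- of `t` with the part of `x` orthogonal to `q`. It is odd under the reflection that fixes the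
  -- axis `ℝ q`.
  set f : USphere (m + 1) → ℝ := fun x => sphereWeight q s x *
    (⟪t, (x : Euc (m + 1)) - q⟫ + ⟪t, (q : Euc (m + 1))⟫ * (‖(x : Euc (m + 1)) - q‖ ^ 2 / 2)) with hf
  suffices hzero : ∫ x, f x ∂surfaceMeasure (m + 1) = 0 by
    rw [← sub_eq_zero, ← integral_sub]
    · rw [← hzero]
      congr 1; ext x; simp only [hf]; ring
    · exact hintegrable _ ((continuous_sphereWeight q s).mul (by fun_prop))
    · exact hintegrable _ ((continuous_sphereWeight q s).mul (by fun_prop))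
  have key := integral_norm_mul_radialExtension f (fun r => Real.exp (-(s * (r - 1)) ^ 2 / 2))
  set R := (ℝ ∙ (q : Euc (m + 1))).reflection with hR
  have hRy : ∀ y : Euc (m + 1), R y = (2 * ⟪(q : Euc (m + 1)), y⟫) • (q : Euc (m + 1)) - y := by
    intro y
    rw [hR, Submodule.reflection_apply, Submodule.starProjection_unit_singleton ℝ hq,
      two_smul, two_mul, add_smul]
  have hodd : ∀ y : Euc (m + 1), radialExtension f (R y) = -radialExtension f y := by
    intro y
    by_cases hy : y = 0
    · simp [hy, radialExtension]
    have hRy0 : R y ≠ 0 := by simpa using hy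
    obtain ⟨x, hx, hfx⟩ := exists_radialExtension_eq hy
    obtain ⟨z, hz, hfz⟩ := exists_radialExtension_eq hRy0
    rw [hfx, hfz]
    have hzx : (z : Euc (m + 1)) = (2 * ⟪(q : Euc (m + 1)), (x : Euc (m + 1))⟫) • (q : Euc (m + 1)) - x := by
      rw [hz, LinearIsometryEquiv.norm_map, ← map_smul, ← hx, hRy]
    have hsq : ∀ x : USphere (m + 1), ‖(x : Euc (m + 1)) - q‖ ^ 2 =
        2 - 2 * ⟪(q : Euc (m + 1)), (x : Euc (m + 1))⟫ := by
      intro x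
      rw [norm_sub_sq_real, hq, norm_usphere, real_inner_comm]; ring
    have hqz : ⟪(q : Euc (m + 1)), (z : Euc (m + 1))⟫ = ⟪(q : Euc (m + 1)), (x : Euc (m + 1))⟫ := by
      rw [hzx, inner_sub_right, real_inner_smul_right, real_inner_self_eq_norm_sq, hq]; ring
    have htz : ⟪t, (z : Euc (m + 1))⟫ =
        2 * ⟪(q : Euc (m + 1)), (x : Euc (m + 1))⟫ * ⟪t, (q : Euc (m + 1))⟫ - ⟪t, (x : Euc (m + 1))⟫ := by
      rw [hzx, inner_sub_right, real_inner_smul_right]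
    simp only [hf, sphereWeight, mul_pow, hsq, hqz, inner_sub_right, htz]
    ring
  -- The symmetry is used in the ambient space, where the reflection preserves Lebesgue measure and
  -- norms. Positivity of the radial integral then carries the vanishing back to the sphere.
  have hflip := R.measurePreserving.integral_comp R.toHomeomorph.measurableEmbedding
    (fun y => Real.exp (-(s * (‖y‖ - 1)) ^ 2 / 2) * radialExtension f y)
  simp only [hodd, LinearIsometryEquiv.norm_map, mul_neg, integral_neg] at hflip
  have h0 : ∫ y : Euc (m + 1), Real.exp (-(s * (‖y‖ - 1)) ^ 2 / 2) * radialExtension f y = 0 := by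
    linarith
  rw [key] at h0
  exact (mul_eq_zero.mp h0).resolve_right (ne_of_gt hs)

/-! ### The density near the query -/

/-- The extension is `ρ` composed with the radial projection, a smooth map from the punctured space
to the sphere. -/
theorem differentiableAt_radialExtension {m : ℕ} {ρ : USphere (m + 1) → ℝ}
    (hρ : ContMDiff (𝓡 m) 𝓘(ℝ, ℝ) 2 ρ) (q : USphere (m + 1)) :
    DifferentiableAt ℝ (radialExtension ρ) (q : Euc (m + 1)) := by
  have hq : (q : Euc (m + 1)) ≠ 0 := fun h => by
    have := norm_usphere q
    simp [h] at this
  let U : TopologicalSpace.Opens (Euc (m + 1)) := ⟨{0}ᶜ, isOpen_compl_singleton⟩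
  have hmem : ∀ y : U, ‖(y : Euc (m + 1))‖⁻¹ • (y : Euc (m + 1)) ∈ Metric.sphere (0 : Euc (m + 1)) 1 :=
    fun y => by simp [norm_smul, inv_mul_cancel₀ (norm_ne_zero_iff.mpr y.2)]
  have hπ : ContMDiff 𝓘(ℝ, Euc (m + 1)) 𝓘(ℝ, Euc (m + 1)) 2
      (fun y : U => ‖(y : Euc (m + 1))‖⁻¹ • (y : Euc (m + 1))) := by
    intro y
    refine (contMDiffAt_subtype_iff (U := U)
      (f := fun y : Euc (m + 1) => ‖y‖⁻¹ • y)).mpr (ContDiffAt.contMDiffAt ?_)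
    have hy : (y : Euc (m + 1)) ≠ 0 := y.2
    exact ((contDiffAt_norm ℝ hy).inv (norm_ne_zero_iff.mpr hy)).smul contDiffAt_id
  have : Fact (Module.finrank ℝ (Euc (m + 1)) = m + 1) := ⟨by simp⟩
  have hcomp : ContMDiff 𝓘(ℝ, Euc (m + 1)) 𝓘(ℝ, ℝ) 2 (fun y : U => radialExtension ρ y) := by
    have h := hρ.comp (hπ.codRestrict_sphere (n := m) hmem)
    refine h.congr fun y => ?_
    have hy : (y : Euc (m + 1)) ≠ 0 := y.2
    simp only [radialExtension, dif_neg hy, Function.comp]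
    rfl
  have := (contMDiffAt_subtype_iff (U := U) (f := radialExtension ρ)).mp (hcomp ⟨q, hq⟩)
  exact this.contDiffAt.differentiableAt (by norm_num)

theorem tendsto_mul_radialExtension_sub {d : ℕ} {ρ : USphere d → ℝ} {q : USphere d} {g : Euc d}
    (hg : HasGradientAt (radialExtension ρ) g (q : Euc d)) (u : Euc d) :
    Tendsto (fun s : ℝ => s * (radialExtension ρ ((q : Euc d) + s⁻¹ • u) - ρ q)) atTop
      (𝓝 ⟪g, u⟫) := by
  have h := hg.hasFDerivAt.lim u (c := fun s : ℝ => s) (l := atTop)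
    (tendsto_norm_atTop_atTop)
  simpa [radialExtension_coe] using h

theorem radialExtension_smul_coe {d : ℕ} (f : USphere d → ℝ) (q : USphere d) {r : ℝ}
    (hr : 0 < r) : radialExtension f (r • (q : Euc d)) = f q := by
  have hq := norm_usphere q
  have hne : r • (q : Euc d) ≠ 0 := by
    rw [← norm_ne_zero_iff, norm_smul, hq, mul_one]
    simpa using hr.ne'
  obtain ⟨x, hx, hf⟩ := exists_radialExtension_eq hne
  rw [hf]
  congr 1
  ext1
  rw [hx, norm_smul, hq, mul_one, Real.norm_of_nonneg hr.le, smul_smul, inv_mul_cancel₀ hr.ne',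
    one_smul]

/-- The extension is constant on the ray through `q`, so its derivative in the direction `q`
vanishes. -/
theorem inner_gradient_radialExtension_eq_zero {d : ℕ} {ρ : USphere d → ℝ} {q : USphere d}
    {g : Euc d} (hg : HasGradientAt (radialExtension ρ) g (q : Euc d)) :
    ⟪g, (q : Euc d)⟫ = 0 := by
  refine tendsto_nhds_unique (tendsto_mul_radialExtension_sub hg (q : Euc d)) ?_
  refine tendsto_const_nhds.congr' ?_
  filter_upwards [eventually_gt_atTop 0] with s hs
  have : (q : Euc d) + s⁻¹ • (q : Euc d) = (1 + s⁻¹) • (q : Euc d) := by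
    rw [add_smul, one_smul]
  rw [this, radialExtension_smul_coe ρ q (by positivity)]
  simp

/-- Differentiability gives the bound in a ball of radius `δ`; outside it, boundedness of `ρ`
suffices, at the cost of `2 M / δ`. It provides the domination for the first moment. -/
theorem exists_abs_sub_le_of_hasGradientAt {d : ℕ} {ρ : USphere d → ℝ} {q : USphere d}
    {g : Euc d} {M : ℝ} (hM : ∀ x, |ρ x| ≤ M)
    (hg : HasGradientAt (radialExtension ρ) g (q : Euc d)) :
    ∃ C, 0 ≤ C ∧ ∀ x : USphere d, |ρ x - ρ q| ≤ C * ‖(x : Euc d) - q‖ := by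
  obtain ⟨C, hC, h⟩ := hg.hasFDerivAt.isBigO_sub.exists_nonneg
  obtain ⟨δ, hδ, hball⟩ := Metric.eventually_nhds_iff.mp h.bound
  have hM0 : 0 ≤ M := (abs_nonneg _).trans (hM q)
  refine ⟨C + 2 * M / δ, by positivity, fun x => ?_⟩
  have hn := norm_nonneg ((x : Euc d) - q)
  by_cases hx : dist (x : Euc d) q < δ
  · have := hball hx
    simp only [radialExtension_coe, Real.norm_eq_abs] at this
    have h2 : 0 ≤ 2 * M / δ * ‖(x : Euc d) - q‖ := by positivity
    linarith
  · rw [not_lt, dist_eq_norm] at hx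
    have h1 : |ρ x - ρ q| ≤ 2 * M := by
      have := abs_sub (ρ x) (ρ q)
      linarith [hM x, hM q]
    have h2 : 2 * M ≤ 2 * M / δ * ‖(x : Euc d) - q‖ := by
      rw [div_mul_eq_mul_div, le_div_iff₀ hδ]
      gcongr
    have h3 : 0 ≤ C * ‖(x : Euc d) - q‖ := by positivity
    linarith

/-! ### Moments of the weight under the key law -/

theorem integral_keyLaw {d : ℕ} {ρ : USphere d → ℝ} (hρ : Continuous ρ) (h0 : ∀ y, 0 ≤ ρ y)
    (f : USphere d → ℝ) :
    ∫ x, f x ∂keyLaw ρ = ∫ x, f x * ρ x ∂surfaceMeasure d := by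
  rw [keyLaw, integral_withDensity_eq_integral_toReal_smul
    (hρ.measurable.ennreal_ofReal) (ae_of_all _ fun _ => by simp)]
  refine integral_congr_ae (ae_of_all _ fun x => ?_)
  simp only [ENNReal.toReal_ofReal (h0 x), smul_eq_mul, mul_comm]

theorem tendsto_pow_mul_integral_keyLaw {m : ℕ} {ρ : USphere (m + 1) → ℝ} (hρ : Continuous ρ)
    (h0 : ∀ y, 0 ≤ ρ y) {q : USphere (m + 1)} {g : Euc (m + 1)}
    (hg : HasGradientAt (radialExtension ρ) g (q : Euc (m + 1))) :
    Tendsto (fun s : ℝ => s ^ m * ∫ x, sphereWeight q s x ∂keyLaw ρ) atTop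
      (𝓝 (√(2 * Real.pi) ^ m * ρ q)) := by
  obtain ⟨M, hM⟩ := isCompact_univ.exists_bound_of_continuousOn hρ.continuousOn
  simp only [Set.mem_univ, forall_const, Real.norm_eq_abs] at hM
  have hM0 : 0 ≤ M := (abs_nonneg _).trans (hM q)
  have key := tendsto_pow_mul_integral_sphereWeight q (fun _ => ρ) (fun _ => ρ q) M
    (fun _ => hρ.measurable) (fun s x => (hM x).trans (by
      nlinarith [sq_nonneg (s * ‖(x : Euc (m + 1)) - q‖), mul_nonneg hM0
        (sq_nonneg (s * ‖(x : Euc (m + 1)) - q‖))])) (fun u => by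
      have := hg.hasFDerivAt.continuousAt.tendsto.comp (tendsto_add_inv_smul (q : Euc (m + 1)) u)
      rwa [radialExtension_coe] at this)
  simpa [integral_keyLaw hρ h0] using key

theorem tendsto_radialExtension_inner {d : ℕ} (q : USphere d) (t u : Euc d) :
    Tendsto (fun s : ℝ => s * radialExtension (fun x => ⟪t, (x : Euc d) - q⟫)
      ((q : Euc d) + s⁻¹ • u)) atTop (𝓝 (⟪t - ⟪(q : Euc d), t⟫ • (q : Euc d), u⟫)) := by
  have h := ((tendsto_const_nhds (x := t)).inner (tendsto_smul_normalize_sub q u) :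
    Tendsto (fun s : ℝ => ⟪t, s • (‖(q : Euc d) + s⁻¹ • u‖⁻¹ • ((q : Euc d) + s⁻¹ • u) - q)⟫)
      atTop _)
  have e : ⟪t, u - ⟪(q : Euc d), u⟫ • (q : Euc d)⟫ = ⟪t - ⟪(q : Euc d), t⟫ • (q : Euc d), u⟫ := by
    rw [inner_sub_right, inner_sub_left, real_inner_smul_right, real_inner_smul_left,
      real_inner_comm t]
    ring
  rw [← e]
  refine h.congr' ?_
  filter_upwards [eventually_add_inv_smul_ne_zero q u] with s hy
  obtain ⟨x, hx, hf⟩ := exists_radialExtension_eq hy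
  rw [hf, ← hx, real_inner_smul_right]

theorem tendsto_pow_mul_integral_inner_sq_keyLaw {m : ℕ} {ρ : USphere (m + 1) → ℝ}
    (hρ : Continuous ρ) (h0 : ∀ y, 0 ≤ ρ y) {q : USphere (m + 1)} {g : Euc (m + 1)}
    (hg : HasGradientAt (radialExtension ρ) g (q : Euc (m + 1))) (t : Euc (m + 1)) :
    Tendsto (fun s : ℝ => s ^ m * (s ^ 2 * ∫ x, sphereWeight q s x *
        ⟪t, (x : Euc (m + 1)) - q⟫ ^ 2 ∂keyLaw ρ)) atTop
      (𝓝 (√(2 * Real.pi) ^ m * (ρ q * (‖t‖ ^ 2 - ⟪(q : Euc (m + 1)), t⟫ ^ 2)))) := by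
  obtain ⟨M, hM⟩ := isCompact_univ.exists_bound_of_continuousOn hρ.continuousOn
  simp only [Set.mem_univ, forall_const, Real.norm_eq_abs] at hM
  have hM0 : 0 ≤ M := (abs_nonneg _).trans (hM q)
  set p := t - ⟪(q : Euc (m + 1)), t⟫ • (q : Euc (m + 1)) with hp
  have key := tendsto_pow_mul_integral_sphereWeight q
    (fun s x => ρ x * (s * ⟪t, (x : Euc (m + 1)) - q⟫) ^ 2) (fun u => ρ q * ⟪p, u⟫ ^ 2)
    (M * ‖t‖ ^ 2)
    (fun s => Continuous.measurable (by fun_prop)) (fun s x => by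
      rw [abs_mul, abs_of_nonneg (sq_nonneg (s * _))]
      have h1 : (s * ⟪t, (x : Euc (m + 1)) - q⟫) ^ 2 ≤
          ‖t‖ ^ 2 * (s * ‖(x : Euc (m + 1)) - q‖) ^ 2 := by
        have h2 := abs_real_inner_le_norm t ((x : Euc (m + 1)) - q)
        have h3 : ⟪t, (x : Euc (m + 1)) - q⟫ ^ 2 ≤ (‖t‖ * ‖(x : Euc (m + 1)) - q‖) ^ 2 :=
          sq_le_sq' (by linarith [neg_abs_le ⟪t, (x : Euc (m + 1)) - q⟫])
            ((le_abs_self _).trans h2)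
        calc (s * ⟪t, (x : Euc (m + 1)) - q⟫) ^ 2 = s ^ 2 * ⟪t, (x : Euc (m + 1)) - q⟫ ^ 2 := by ring
          _ ≤ s ^ 2 * (‖t‖ * ‖(x : Euc (m + 1)) - q‖) ^ 2 := by gcongr
          _ = _ := by ring
      calc |ρ x| * (s * ⟪t, (x : Euc (m + 1)) - q⟫) ^ 2
          ≤ M * (‖t‖ ^ 2 * (s * ‖(x : Euc (m + 1)) - q‖) ^ 2) := by
            gcongr
            exact hM x
        _ ≤ M * ‖t‖ ^ 2 * (1 + (s * ‖(x : Euc (m + 1)) - q‖) ^ 2) := by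
            have : 0 ≤ M * ‖t‖ ^ 2 := by positivity
            linarith) (fun u => by
      have h1 := hg.hasFDerivAt.continuousAt.tendsto.comp (tendsto_add_inv_smul (q : Euc (m + 1)) u)
      rw [radialExtension_coe] at h1
      refine (h1.mul ((tendsto_radialExtension_inner q t u).pow 2)).congr' ?_
      filter_upwards [eventually_add_inv_smul_ne_zero q u] with s hy
      obtain ⟨x, hx, hf⟩ := exists_radialExtension_eq hy
      simp only [Function.comp, hf])
  have e : ∫ u, ρ q * ⟪p, u⟫ ^ 2 ∂stdGaussian (Euc (m + 1)) =
      ρ q * (‖t‖ ^ 2 - ⟪(q : Euc (m + 1)), t⟫ ^ 2) := by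
    rw [integral_const_mul]
    simp_rw [pow_two ⟪p, _⟫]
    rw [integral_inner_mul_inner_stdGaussian, real_inner_self_eq_norm_sq, hp,
      norm_sub_inner_smul_sq]
  rw [e] at key
  refine key.congr fun s => ?_
  rw [integral_keyLaw hρ h0, ← integral_const_mul (s ^ 2)]
  congr 2
  ext x
  ring

/-- Write `ρ = ρ q + (ρ - ρ q)`. Symmetry replaces `⟨t, x - q⟩` against the constant by a term
quadratic in `‖x - q‖`, and the increment of `ρ` pairs with `⟨t, x - q⟩` to second order as well.
Everything is then of order `s⁻²`, and the Laplace method applies. The factor `m` is the trace of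
the tangent projection. -/
theorem tendsto_pow_mul_integral_inner_keyLaw {m : ℕ} {ρ : USphere (m + 1) → ℝ}
    (hρ : Continuous ρ) (h0 : ∀ y, 0 ≤ ρ y) {q : USphere (m + 1)} {g : Euc (m + 1)}
    (hg : HasGradientAt (radialExtension ρ) g (q : Euc (m + 1))) (t : Euc (m + 1)) :
    Tendsto (fun s : ℝ => s ^ m * (s ^ 2 * ∫ x, sphereWeight q s x *
        ⟪t, (x : Euc (m + 1)) - q⟫ ∂keyLaw ρ)) atTop
      (𝓝 (√(2 * Real.pi) ^ m * (⟪t, g⟫ - ρ q * ⟪t, (q : Euc (m + 1))⟫ * (m / 2)))) := by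
  obtain ⟨M, hM⟩ := isCompact_univ.exists_bound_of_continuousOn hρ.continuousOn
  simp only [Set.mem_univ, forall_const, Real.norm_eq_abs] at hM
  obtain ⟨C, hC0, hC⟩ := exists_abs_sub_le_of_hasGradientAt hM hg
  have hfin : IsFiniteMeasure (surfaceMeasure (m + 1)) := by
    unfold surfaceMeasure; infer_instance
  have hintegrable : ∀ f : USphere (m + 1) → ℝ, Continuous f → Integrable f (surfaceMeasure (m + 1)) :=
    fun f hf => hf.integrable_of_hasCompactSupport (HasCompactSupport.of_compactSpace f)
  set p := t - ⟪(q : Euc (m + 1)), t⟫ • (q : Euc (m + 1)) with hp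
  set c := ρ q * ⟪t, (q : Euc (m + 1))⟫ / 2 with hc
  have key := tendsto_pow_mul_integral_sphereWeight q
    (fun s x => (s * ⟪t, (x : Euc (m + 1)) - q⟫) * (s * (ρ x - ρ q)) -
      c * (s * ‖(x : Euc (m + 1)) - q‖) ^ 2)
    (fun u => ⟪p, u⟫ * ⟪g, u⟫ - c * (‖u‖ ^ 2 - ⟪(q : Euc (m + 1)), u⟫ * ⟪(q : Euc (m + 1)), u⟫))
    (‖t‖ * C + |c|)
    (fun s => Continuous.measurable (by fun_prop)) (fun s x => by
      have h1 := abs_real_inner_le_norm t ((x : Euc (m + 1)) - q)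
      calc |(s * ⟪t, (x : Euc (m + 1)) - q⟫) * (s * (ρ x - ρ q)) -
            c * (s * ‖(x : Euc (m + 1)) - q‖) ^ 2|
          ≤ |(s * ⟪t, (x : Euc (m + 1)) - q⟫) * (s * (ρ x - ρ q))| +
            |c * (s * ‖(x : Euc (m + 1)) - q‖) ^ 2| := abs_sub _ _
        _ = s ^ 2 * (|⟪t, (x : Euc (m + 1)) - q⟫| * |ρ x - ρ q|) +
            |c| * (s * ‖(x : Euc (m + 1)) - q‖) ^ 2 := by
            simp only [abs_mul, abs_pow, abs_norm, mul_pow]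
            linear_combination (|⟪t, (x : Euc (m + 1)) - q⟫| * |ρ x - ρ q| +
              |c| * ‖(x : Euc (m + 1)) - q‖ ^ 2) * sq_abs s
        _ ≤ s ^ 2 * ((‖t‖ * ‖(x : Euc (m + 1)) - q‖) * (C * ‖(x : Euc (m + 1)) - q‖)) +
            |c| * (s * ‖(x : Euc (m + 1)) - q‖) ^ 2 := by
            gcongr
            exact hC x
        _ = (‖t‖ * C + |c|) * (s * ‖(x : Euc (m + 1)) - q‖) ^ 2 := by ring
        _ ≤ _ := by
            gcongr
            linarith) (fun u => by
      have h2 := (tendsto_smul_normalize_sub q u).norm.pow 2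
      rw [norm_sub_inner_smul_sq, pow_two ⟪(q : Euc (m + 1)), u⟫] at h2
      refine (((tendsto_radialExtension_inner q t u).mul
        (tendsto_mul_radialExtension_sub hg u)).sub (h2.const_mul c)).congr' ?_
      filter_upwards [eventually_add_inv_smul_ne_zero q u, eventually_gt_atTop 0] with s hy hs
      obtain ⟨x, hx, hf⟩ := exists_radialExtension_eq hy
      simp only [hf, ← hx]
      rw [norm_smul, Real.norm_of_nonneg hs.le])
  have e : ∫ u, (⟪p, u⟫ * ⟪g, u⟫ - c * (‖u‖ ^ 2 - ⟪(q : Euc (m + 1)), u⟫ * ⟪(q : Euc (m + 1)), u⟫))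
      ∂stdGaussian (Euc (m + 1)) =
      ⟪t, g⟫ - ρ q * ⟪t, (q : Euc (m + 1))⟫ * (m / 2) := by
    have i1 := integrable_inner_mul_inner_stdGaussian p g
    have i2 := integrable_inner_mul_inner_stdGaussian (q : Euc (m + 1)) (q : Euc (m + 1))
    have i3 := integrable_norm_sq_stdGaussian (d := m + 1)
    have i4 : Integrable (fun u => c * (‖u‖ ^ 2 -
        ⟪(q : Euc (m + 1)), u⟫ * ⟪(q : Euc (m + 1)), u⟫)) (stdGaussian (Euc (m + 1))) :=
      (i3.sub i2).const_mul c
    rw [integral_sub i1 i4, integral_const_mul, integral_sub i3 i2,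
      integral_inner_mul_inner_stdGaussian, integral_inner_mul_inner_stdGaussian,
      integral_norm_sq_stdGaussian, real_inner_self_eq_norm_sq, norm_usphere, hp, inner_sub_left,
      real_inner_smul_left, real_inner_comm g (q : Euc (m + 1)),
      inner_gradient_radialExtension_eq_zero hg]
    push_cast
    ring
  rw [e] at key
  have hN := (tendsto_mul_integral_pow_mul_exp m).eventually (lt_mem_nhds
    (show 0 < √(2 * Real.pi) by positivity))
  refine key.congr' ?_
  filter_upwards [hN, eventually_gt_atTop 0] with s hNs hs
  have hpos := pos_of_mul_pos_right hNs hs.le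
  have hsym := integral_sphereWeight_mul_inner_sub q t s hpos
  have hw := continuous_sphereWeight q s
  congr 1
  rw [integral_keyLaw hρ h0]
  -- Only the second integral would be of order `s⁻¹` by size alone; `hsym` exposes its
  -- cancellation.
  have d1 : ∫ x, sphereWeight q s x * ⟪t, (x : Euc (m + 1)) - q⟫ * ρ x ∂surfaceMeasure (m + 1) =
      ∫ x, sphereWeight q s x * ⟪t, (x : Euc (m + 1)) - q⟫ * (ρ x - ρ q) ∂surfaceMeasure (m + 1) +
      ρ q * ∫ x, sphereWeight q s x * ⟪t, (x : Euc (m + 1)) - q⟫ ∂surfaceMeasure (m + 1) := by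
    rw [← integral_const_mul, ← integral_add (hintegrable _ (by fun_prop)) (hintegrable _ (by fun_prop))]
    congr 1; ext x; ring
  rw [d1, hsym, ← integral_const_mul, ← integral_add (hintegrable _ (by fun_prop)) (hintegrable _ (by fun_prop)),
    ← integral_const_mul]
  congr 1; ext x
  rw [hc]
  ring

theorem sphericalGradient_log {m : ℕ} {ρ : USphere (m + 1) → ℝ} {q : USphere (m + 1)}
    {g : Euc (m + 1)} (hg : HasGradientAt (radialExtension ρ) g (q : Euc (m + 1)))
    (hq : 0 < ρ q) :
    sphericalGradient (fun x => Real.log (ρ x)) q = (ρ q)⁻¹ • g := by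
  have h : HasGradientAt (radialExtension fun x => Real.log (ρ x)) ((ρ q)⁻¹ • g)
      (q : Euc (m + 1)) := by
    rw [hasGradientAt_iff_hasFDerivAt]
    have h1 := hg.hasFDerivAt.log (by rw [radialExtension_coe]; exact hq.ne')
    rw [radialExtension_coe] at h1
    rw [map_smul]
    refine h1.congr_of_eventuallyEq ?_
    have hq0 : (q : Euc (m + 1)) ≠ 0 := fun h => by
      have := norm_usphere q
      simp [h] at this
    filter_upwards [isOpen_ne.mem_nhds hq0] with y hy
    obtain ⟨x, hx, hf⟩ := exists_radialExtension_eq hy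
    simp only [hf]
  exact h.gradient

/-! ### Sums of rows of small independent vectors -/

theorem norm_cexp_mul_I_sub_taylor_le {y : ℝ} (hy : |y| ≤ 1) :
    ‖Complex.exp (y * Complex.I) - (1 + y * Complex.I - y ^ 2 / 2)‖ ≤ |y| ^ 3 := by
  have h := Complex.exp_bound (x := y * Complex.I) (by simpa using hy) (n := 3) (by norm_num)
  have e : ∑ i ∈ Finset.range 3, ((y : ℂ) * Complex.I) ^ i / (i.factorial : ℂ) =
      1 + y * Complex.I - y ^ 2 / 2 := by
    simp [Finset.sum_range_succ, mul_pow, Nat.factorial]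
    ring
  rw [e] at h
  refine h.trans ?_
  have : ‖(y : ℂ) * Complex.I‖ = |y| := by simp
  rw [this]
  have h3 : 0 ≤ |y| ^ 3 := by positivity
  norm_num [Nat.factorial]
  nlinarith

/-- Characteristic functions of the row sums of a triangular array of uniformly small
independent vectors that are identically distributed in each row. -/
theorem tendsto_charFun_sum_of_small {Ω S E : Type*} [MeasurableSpace Ω] [MeasurableSpace S]
    [NormedAddCommGroup E] [InnerProductSpace ℝ E] [MeasurableSpace E] [BorelSpace E]
    [SecondCountableTopology E]
    {P : Measure Ω} [IsProbabilityMeasure P] {κ : Measure S} {x : ℕ → Ω → S}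
    (hindep : iIndepFun x P) (hlaw : ∀ i, HasLaw (x i) κ P)
    {f : ℕ → S → E} (hf : ∀ n, Measurable (f n)) {ε : ℕ → ℝ} (hε : Tendsto ε atTop (𝓝 0))
    (hbound : ∀ᶠ n in atTop, ∀ y, ‖f n y‖ ≤ ε n) {t : E} {a b : ℝ}
    (ha : Tendsto (fun n : ℕ => n * ∫ y, ⟪f n y, t⟫ ∂κ) atTop (𝓝 a))
    (hb : Tendsto (fun n : ℕ => n * ∫ y, ⟪f n y, t⟫ ^ 2 ∂κ) atTop (𝓝 b)) :
    Tendsto (fun n : ℕ => charFun (P.map fun ω => ∑ j ∈ Finset.range n, f n (x j ω)) t) atTop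
      (𝓝 (Complex.exp (a * Complex.I - b / 2))) := by
  have hκ : IsProbabilityMeasure κ := by
    rw [← (hlaw 0).map_eq]
    exact Measure.isProbabilityMeasure_map (hlaw 0).aemeasurable
  -- By independence and equal laws the characteristic function is an `n`-th power, so it suffices
  -- to find the limit of `n (φ - 1)`, with `φ` that of one summand.
  have hpow : ∀ n : ℕ, charFun (P.map fun ω => ∑ j ∈ Finset.range n, f n (x j ω)) t =
      (1 + (∫ y, Complex.exp (⟪f n y, t⟫ * Complex.I) ∂κ - 1)) ^ n := by
    intro n
    have hi : iIndepFun (fun j => f n ∘ x j) P := hindep.comp (fun _ => f n) fun _ => hf n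
    have hm : ∀ j, AEMeasurable (f n ∘ x j) P := fun j => (hf n).comp_aemeasurable (hlaw j).aemeasurable
    have h := (hi.restrict (Finset.range n)).charFun_map_fun_finsetSum_eq_prod
      (fun j _ => hm j)
    have h' := congrFun h t
    simp only [Function.comp_apply] at h'
    rw [h', Finset.prod_apply]
    have hc : ∀ j, charFun (P.map (f n ∘ x j)) t = ∫ y, Complex.exp (⟪f n y, t⟫ * Complex.I) ∂κ := by
      intro j
      rw [← AEMeasurable.map_map_of_aemeasurable (hf n).aemeasurable (hlaw j).aemeasurable,
        (hlaw j).map_eq, charFun_apply, integral_map (hf n).aemeasurable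
          (Measurable.aestronglyMeasurable (by fun_prop))]
    simp only [hc]
    simp
  simp_rw [hpow]
  refine Complex.tendsto_one_add_pow_exp_of_tendsto ?_
  have hmain : Tendsto (fun n : ℕ => (((n * ∫ y, ⟪f n y, t⟫ ∂κ : ℝ) : ℂ) * Complex.I -
      ((n * ∫ y, ⟪f n y, t⟫ ^ 2 ∂κ : ℝ) : ℂ) / 2)) atTop (𝓝 (a * Complex.I - b / 2)) :=
    (((Complex.continuous_ofReal.tendsto _).comp ha).mul_const _).sub
      (((Complex.continuous_ofReal.tendsto _).comp hb).div_const _)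
  have hε' : Tendsto (fun n => ε n * ‖t‖) atTop (𝓝 0) := by simpa using hε.mul_const ‖t‖
  -- The cubic Taylor remainder is at most `ε n ‖t‖` times the square, and `n` times the second
  -- moment converges. Uniform smallness thus plays the role of a Lindeberg condition.
  have hrem : Tendsto (fun n : ℕ => (n : ℂ) * (∫ y, Complex.exp (⟪f n y, t⟫ * Complex.I) ∂κ - 1) -
      (((n * ∫ y, ⟪f n y, t⟫ ∂κ : ℝ) : ℂ) * Complex.I -
      ((n * ∫ y, ⟪f n y, t⟫ ^ 2 ∂κ : ℝ) : ℂ) / 2)) atTop (𝓝 0) := by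
    have hz : Tendsto (fun n : ℕ => (ε n * ‖t‖) * (n * ∫ y, ⟪f n y, t⟫ ^ 2 ∂κ)) atTop (𝓝 0) := by
      simpa using hε'.mul hb
    refine squeeze_zero_norm' ?_ hz
    filter_upwards [hε'.eventually (ge_mem_nhds one_pos), hbound] with n hn hbn
    have hsmall : ∀ y, |⟪f n y, t⟫| ≤ ε n * ‖t‖ := fun y =>
      (abs_real_inner_le_norm _ _).trans (by gcongr; exact hbn y)
    have hmeas : Measurable fun y => ⟪f n y, t⟫ := (hf n).inner_const
    have i1 : Integrable (fun y => ⟪f n y, t⟫) κ :=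
      Integrable.of_bound hmeas.aestronglyMeasurable (ε n * ‖t‖) (ae_of_all _ fun y => hsmall y)
    have i2 : Integrable (fun y => ⟪f n y, t⟫ ^ 2) κ :=
      Integrable.of_bound (hmeas.pow_const 2).aestronglyMeasurable ((ε n * ‖t‖) ^ 2)
        (ae_of_all _ fun y => by
          rw [norm_pow, Real.norm_eq_abs]
          have := hsmall y
          gcongr)
    have i3 : Integrable (fun y => Complex.exp (⟪f n y, t⟫ * Complex.I)) κ :=
      Integrable.of_bound (Measurable.aestronglyMeasurable (by fun_prop)) 1
        (ae_of_all _ fun y => by rw [Complex.norm_exp_ofReal_mul_I])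
    have i1' : Integrable (fun y => (⟪f n y, t⟫ : ℂ) * Complex.I) κ := i1.ofReal.mul_const _
    have i2' : Integrable (fun y => (⟪f n y, t⟫ : ℂ) ^ 2 / 2) κ := by
      have := i2.ofReal (𝕜 := ℂ)
      simp only [Complex.coe_algebraMap, RCLike.ofReal_pow] at this
      exact this.div_const 2
    have e : (n : ℂ) * (∫ y, Complex.exp (⟪f n y, t⟫ * Complex.I) ∂κ - 1) -
        (((n * ∫ y, ⟪f n y, t⟫ ∂κ : ℝ) : ℂ) * Complex.I -
        ((n * ∫ y, ⟪f n y, t⟫ ^ 2 ∂κ : ℝ) : ℂ) / 2) =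
        n * ∫ y, (Complex.exp (⟪f n y, t⟫ * Complex.I) -
          (1 + ⟪f n y, t⟫ * Complex.I - (⟪f n y, t⟫ : ℂ) ^ 2 / 2)) ∂κ := by
      have i4 : Integrable (fun y => 1 + (⟪f n y, t⟫ : ℂ) * Complex.I) κ :=
        (integrable_const _).add i1'
      have i5 : Integrable (fun y => 1 + (⟪f n y, t⟫ : ℂ) * Complex.I - (⟪f n y, t⟫ : ℂ) ^ 2 / 2) κ :=
        i4.sub i2'
      rw [integral_sub i3 i5, integral_sub i4 i2', integral_add (integrable_const _) i1',
        integral_mul_const, integral_div, integral_const]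
      push_cast
      rw [← integral_complex_ofReal, ← integral_complex_ofReal]
      simp
      ring
    rw [e, norm_mul, Complex.norm_natCast]
    have h1 : ‖∫ y, (Complex.exp (⟪f n y, t⟫ * Complex.I) -
          (1 + ⟪f n y, t⟫ * Complex.I - (⟪f n y, t⟫ : ℂ) ^ 2 / 2)) ∂κ‖ ≤
        ∫ y, (ε n * ‖t‖) * ⟪f n y, t⟫ ^ 2 ∂κ := by
      refine norm_integral_le_of_norm_le (i2.const_mul _) (ae_of_all _ fun y => ?_)
      refine (norm_cexp_mul_I_sub_taylor_le ((hsmall y).trans hn)).trans ?_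
      rw [pow_succ', sq_abs]
      gcongr
      exact hsmall y
    rw [integral_const_mul] at h1
    calc (n : ℝ) * _ ≤ n * ((ε n * ‖t‖) * ∫ y, ⟪f n y, t⟫ ^ 2 ∂κ) := by gcongr
      _ = _ := by ring
  simpa using hrem.add hmain

/-- Convergence in distribution to a constant implies convergence in probability. -/
theorem tendstoInMeasure_of_tendstoInDistribution_const {Ω Ω' E ι : Type*} [MeasurableSpace Ω]
    [MeasurableSpace Ω'] [PseudoEMetricSpace E] [MeasurableSpace E] [BorelSpace E]
    {P : Measure Ω} [IsProbabilityMeasure P] {P' : Measure Ω'} [IsProbabilityMeasure P']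
    {l : Filter ι} {X : ι → Ω → E} {c : E}
    (h : TendstoInDistribution X l (fun _ : Ω' => c) (fun _ => P) P') :
    TendstoInMeasure P X l (fun _ => c) := by
  intro ε hε
  set A : Set E := {y | ε ≤ edist y c} with hA
  have hAc : IsClosed A := isClosed_le continuous_const (by fun_prop)
  have hc : c ∉ A := by simp [hA, hε.ne']
  have hmap : P'.map (fun _ : Ω' => c) = Measure.dirac c := by
    rw [Measure.map_const]; simp
  -- Portmanteau: the closed set `A` misses `c`, so its frontier is null for the Dirac mass.
  have key := ProbabilityMeasure.tendsto_measure_of_null_frontier_of_tendsto' h.tendsto (E := A) (by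
    simp only [ProbabilityMeasure.coe_mk, hmap]
    rw [Measure.dirac_apply' _ isClosed_frontier.measurableSet]
    exact Set.indicator_of_notMem (fun hf => hc (hAc.frontier_subset hf)) _)
  simp only [ProbabilityMeasure.coe_mk, hmap, Measure.dirac_apply' _ hAc.measurableSet,
    Set.indicator_of_notMem hc] at key
  refine key.congr fun i => ?_
  rw [Measure.map_apply_of_aemeasurable (h.forall_aemeasurable i) hAc.measurableSet]
  rfl

theorem tendstoInMeasure_inv_one {Ω ι : Type*} [MeasurableSpace Ω] {P : Measure Ω}
    {l : Filter ι} {D : ι → Ω → ℝ} (h : TendstoInMeasure P D l (fun _ => 1)) :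
    TendstoInMeasure P (fun i ω => (D i ω)⁻¹) l (fun _ => 1) := by
  rw [tendstoInMeasure_iff_norm] at h ⊢
  intro ε hε
  refine tendsto_of_tendsto_of_tendsto_of_le_of_le tendsto_const_nhds
    (h (min (1 / 2) (ε / 2)) (by positivity)) (fun _ => zero_le) fun i => measure_mono fun ω hω => ?_
  simp only [Set.mem_ofPred_eq, Real.norm_eq_abs] at hω ⊢
  by_contra! hlt
  obtain ⟨h1, h2⟩ := lt_min_iff.mp hlt
  have hD : 1 / 2 < D i ω := by linarith [(abs_lt.mp h1).1]
  have hD0 : 0 < D i ω := by linarith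
  have e : (D i ω)⁻¹ - 1 = -(D i ω - 1) / D i ω := by field_simp; ring
  rw [e, abs_div, abs_neg, abs_of_pos hD0, le_div_iff₀ hD0] at hω
  nlinarith

theorem tendstoInDistribution_of_tendsto_charFun {Ω Ω' E : Type*} [MeasurableSpace Ω]
    [MeasurableSpace Ω'] [NormedAddCommGroup E] [InnerProductSpace ℝ E] [FiniteDimensional ℝ E]
    [MeasurableSpace E] [BorelSpace E] {P : Measure Ω} [IsProbabilityMeasure P]
    {P' : Measure Ω'} [IsProbabilityMeasure P'] {X : ℕ → Ω → E} {Z : Ω' → E}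
    (hX : ∀ n, AEMeasurable (X n) P) (hZ : AEMeasurable Z P')
    (h : ∀ t, Tendsto (fun n => charFun (P.map (X n)) t) atTop (𝓝 (charFun (P'.map Z) t))) :
    TendstoInDistribution X atTop Z (fun _ => P) P' where
  forall_aemeasurable := hX
  aemeasurable_limit := hZ
  tendsto := ProbabilityMeasure.tendsto_iff_tendsto_charFun.2 h

theorem tendstoInDistribution_congr_eventually {Ω Ω' E ι : Type*} [MeasurableSpace Ω]
    [MeasurableSpace Ω'] [TopologicalSpace E] [MeasurableSpace E] [OpensMeasurableSpace E]
    {P : Measure Ω} [IsProbabilityMeasure P] {P' : Measure Ω'} [IsProbabilityMeasure P']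
    {l : Filter ι} {X Y : ι → Ω → E} {Z : Ω' → E}
    (h : TendstoInDistribution X l Z (fun _ => P) P') (hY : ∀ i, AEMeasurable (Y i) P)
    (hXY : ∀ᶠ i in l, X i = Y i) : TendstoInDistribution Y l Z (fun _ => P) P' where
  forall_aemeasurable := hY
  aemeasurable_limit := h.aemeasurable_limit
  tendsto := h.tendsto.congr' (hXY.mono fun _ hi => 
    Subtype.ext (congrArg (fun X => P.map X) hi))

/-! ### The limiting covariance -/

theorem toEuclideanCLM_tangentProj {d : ℕ} (q : USphere d) (u : Euc d) :
    Matrix.toEuclideanCLM (𝕜 := ℝ) (tangentProj q) u = u - ⟪(q : Euc d), u⟫ • (q : Euc d) := by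
  ext i
  rw [Matrix.ofLp_toEuclideanCLM, tangentProj, Matrix.sub_mulVec, Matrix.one_mulVec]
  simp only [Pi.sub_apply, PiLp.sub_apply, PiLp.smul_apply, smul_eq_mul]
  congr 1
  simp only [Matrix.mulVec, dotProduct, Matrix.vecMulVec_apply, PiLp.inner_apply,
    RCLike.inner_apply, conj_trivial]
  rw [Finset.sum_mul]
  exact Finset.sum_congr rfl fun j _ => by ring

theorem posSemidef_tangentProj {d : ℕ} (q : USphere d) : (tangentProj q).PosSemidef := by
  refine Matrix.PosSemidef.of_dotProduct_mulVec_nonneg ?_ fun v => ?_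
  · rw [Matrix.IsHermitian, Matrix.conjTranspose_eq_transpose_of_trivial, tangentProj,
      Matrix.transpose_sub, Matrix.transpose_one, Matrix.transpose_vecMulVec]
  · have h := Matrix.inner_toEuclideanCLM (tangentProj q) (WithLp.toLp 2 v) (WithLp.toLp 2 v)
    rw [toEuclideanCLM_tangentProj] at h
    simp only [star_trivial]
    rw [← h, inner_sub_right, real_inner_smul_right, real_inner_self_eq_norm_sq,
      real_inner_comm (q : Euc d) (WithLp.toLp 2 v)]
    have h2 := abs_real_inner_le_norm (q : Euc d) (WithLp.toLp 2 v)
    rw [norm_usphere, one_mul] at h2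
    have h3 := sq_le_sq' (by linarith [neg_abs_le ⟪(q : Euc d), WithLp.toLp 2 v⟫])
      ((le_abs_self _).trans h2)
    nlinarith [h3]

theorem covConst_nonneg (d : ℕ) : 0 ≤ covConst d := by
  unfold covConst; positivity

theorem posSemidef_attnCov {d : ℕ} {ρ : USphere d → ℝ} {q : USphere d} (hq : 0 < ρ q)
    (V : Matrix (Fin d) (Fin d) ℝ) {b : ℝ} (hb : 0 ≤ b) :
    (b • (V * attnCov ρ q * V.transpose)).PosSemidef := by
  have h : (attnCov ρ q).PosSemidef :=
    (posSemidef_tangentProj q).smul (div_nonneg (covConst_nonneg d) hq.le)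
  have h2 := h.mul_mul_conjTranspose_same V
  rw [Matrix.conjTranspose_eq_transpose_of_trivial] at h2
  exact h2.smul hb

theorem dotProduct_attnCov_mulVec {d : ℕ} (ρ : USphere d → ℝ) (q : USphere d)
    (V : Matrix (Fin d) (Fin d) ℝ) (b : ℝ) (t : Euc d) :
    t.ofLp ⬝ᵥ (b • (V * attnCov ρ q * V.transpose)).mulVec t.ofLp =
      b * (covConst d / ρ q *
        (‖ContinuousLinearMap.adjoint (Matrix.toEuclideanCLM (𝕜 := ℝ) V) t‖ ^ 2 -
          ⟪(q : Euc d), ContinuousLinearMap.adjoint (Matrix.toEuclideanCLM (𝕜 := ℝ) V) t⟫ ^ 2)) := by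
  have hVT : Matrix.toEuclideanCLM (𝕜 := ℝ) V.transpose =
      ContinuousLinearMap.adjoint (Matrix.toEuclideanCLM (𝕜 := ℝ) V) := by
    rw [← Matrix.conjTranspose_eq_transpose_of_trivial, ← Matrix.star_eq_conjTranspose, map_star]
    rfl
  rw [← Matrix.inner_toEuclideanCLM, map_smul, map_mul, map_mul, attnCov, map_smul, hVT]
  set A := ContinuousLinearMap.adjoint (Matrix.toEuclideanCLM (𝕜 := ℝ) V)
  rw [_root_.smul_apply, mul_apply_eq_comp, mul_apply_eq_comp,
    _root_.smul_apply, toEuclideanCLM_tangentProj, real_inner_smul_right,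
    ← ContinuousLinearMap.adjoint_inner_left, real_inner_smul_right, inner_sub_right,
    real_inner_smul_right, real_inner_self_eq_norm_sq, real_inner_comm (q : Euc d) (A t)]
  ring

/-- This is the form in which the constant emerges from dividing the second moment of `w (x - q)` by
the square of the mean of `w`. -/
theorem covConst_succ (m : ℕ) :
    covConst (m + 1) = (2 * √2 ^ m * √(2 * Real.pi) ^ m)⁻¹ := by
  have h1 : √2 ^ m * √(2 * Real.pi) ^ m = 2 ^ m * Real.pi ^ ((m : ℝ) / 2) := by
    have : √2 * √(2 * Real.pi) = 2 * √Real.pi := by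
      rw [Real.sqrt_mul (by norm_num), ← mul_assoc, Real.mul_self_sqrt (by norm_num)]
    rw [← mul_pow, this, mul_pow, Real.sqrt_eq_rpow, ← Real.rpow_natCast (Real.pi ^ (1 / 2 : ℝ)),
      ← Real.rpow_mul Real.pi_pos.le]
    congr 2
    ring
  rw [mul_assoc, h1, covConst, Real.rpow_neg (by norm_num), Real.rpow_natCast]
  have h2 : -(((m + 1 : ℕ) : ℝ) - 1) / 2 = -((m : ℝ) / 2) := by push_cast; ring
  rw [h2, Real.rpow_neg Real.pi_pos.le, ← mul_inv, pow_succ]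
  congr 1
  ring

/-! ### Squared weights -/

/-- Squaring a Gaussian only rescales its width, so the moments of the squared weight follow from
those of the weight at `√2 * s`. -/
theorem sphereWeight_sq {d : ℕ} (q : USphere d) (s : ℝ) (x : USphere d) :
    sphereWeight q s x ^ 2 = sphereWeight q (√2 * s) x := by
  rw [sphereWeight, sphereWeight, ← Real.exp_nat_mul]
  congr 1
  rw [mul_assoc √2, mul_pow √2, Real.sq_sqrt (by norm_num)]
  push_cast
  ring

theorem tendsto_sqrt_two_mul_atTop : Tendsto (fun s : ℝ => √2 * s) atTop atTop :=
  tendsto_id.const_mul_atTop (by positivity)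

theorem tendsto_pow_mul_integral_sq_keyLaw {m : ℕ} {ρ : USphere (m + 1) → ℝ} (hρ : Continuous ρ)
    (h0 : ∀ y, 0 ≤ ρ y) {q : USphere (m + 1)} {g : Euc (m + 1)}
    (hg : HasGradientAt (radialExtension ρ) g (q : Euc (m + 1))) :
    Tendsto (fun s : ℝ => s ^ m * ∫ x, sphereWeight q s x ^ 2 ∂keyLaw ρ) atTop
      (𝓝 (√(2 * Real.pi) ^ m * ρ q / √2 ^ m)) := by
  refine (((tendsto_pow_mul_integral_keyLaw hρ h0 hg).comp
    tendsto_sqrt_two_mul_atTop).div_const (√2 ^ m)).congr fun s => ?_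
  have : √2 ^ m ≠ 0 := by positivity
  simp only [Function.comp, sphereWeight_sq, mul_pow]
  field_simp

theorem tendsto_pow_mul_integral_sq_mul_inner_sq_keyLaw {m : ℕ} {ρ : USphere (m + 1) → ℝ}
    (hρ : Continuous ρ) (h0 : ∀ y, 0 ≤ ρ y) {q : USphere (m + 1)} {g : Euc (m + 1)}
    (hg : HasGradientAt (radialExtension ρ) g (q : Euc (m + 1))) (t : Euc (m + 1)) :
    Tendsto (fun s : ℝ => s ^ m * (s ^ 2 * ∫ x, sphereWeight q s x ^ 2 *
        ⟪t, (x : Euc (m + 1)) - q⟫ ^ 2 ∂keyLaw ρ)) atTop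
      (𝓝 (√(2 * Real.pi) ^ m * (ρ q * (‖t‖ ^ 2 - ⟪(q : Euc (m + 1)), t⟫ ^ 2)) /
        (√2 ^ m * 2))) := by
  refine (((tendsto_pow_mul_integral_inner_sq_keyLaw hρ h0 hg t).comp
    tendsto_sqrt_two_mul_atTop).div_const (√2 ^ m * 2)).congr fun s => ?_
  have : √2 ^ m ≠ 0 := by positivity
  simp only [Function.comp, sphereWeight_sq]
  rw [mul_pow √2 s 2, Real.sq_sqrt (by norm_num), mul_pow]
  field_simp

/-- From `u ≤ 1 + u² / 2 ≤ exp (u² / 2)`. This makes the summands of the numerator uniformly small.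
-/
theorem mul_sphereWeight_mul_norm_le {d : ℕ} (q : USphere d) (s : ℝ) (x : USphere d) :
    s * (sphereWeight q s x * ‖(x : Euc d) - q‖) ≤ 1 := by
  set u := s * ‖(x : Euc d) - q‖ with hu
  have h1 : u ≤ Real.exp (u ^ 2 / 2) := by
    nlinarith [Real.add_one_le_exp (u ^ 2 / 2), sq_nonneg (u - 1)]
  calc s * (sphereWeight q s x * ‖(x : Euc d) - q‖) = u * Real.exp (-u ^ 2 / 2) := by
        rw [sphereWeight, ← hu, hu]; ring
    _ ≤ Real.exp (u ^ 2 / 2) * Real.exp (-u ^ 2 / 2) := by gcongr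
    _ = 1 := by rw [← Real.exp_add]; ring_nf; simp

/-! ### The attention output as a ratio -/

theorem exp_mul_inner_eq {d : ℕ} {β : ℝ} (hβ : 0 ≤ β) (q x : USphere d) :
    Real.exp (β * ⟪(q : Euc d), (x : Euc d)⟫) = Real.exp β * sphereWeight q √β x := by
  rw [sphereWeight, ← Real.exp_add, mul_pow, Real.sq_sqrt hβ, norm_sub_sq_real, norm_usphere,
    norm_usphere, real_inner_comm]
  congr 1
  ring

/-- The attention weights sum to one, so `V q` can be moved inside the average. -/
theorem attnDisplacement_eq {d : ℕ} {β : ℝ} (hβ : 0 ≤ β) (V : Matrix (Fin d) (Fin d) ℝ)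
    (q : USphere d) (x : ℕ → USphere d) {n : ℕ} (hn : 0 < n) :
    attnDisplacement β V q x n = (∑ j ∈ Finset.range n, sphereWeight q √β (x j))⁻¹ •
      ∑ j ∈ Finset.range n, sphereWeight q √β (x j) •
        Matrix.toEuclideanCLM (𝕜 := ℝ) V ((x j : Euc d) - q) := by
  set W := ∑ j ∈ Finset.range n, sphereWeight q √β (x j) with hW
  have hW0 : W ≠ 0 := (Finset.sum_pos (fun j _ => sphereWeight_pos q _ _)
    (Finset.nonempty_range_iff.mpr hn.ne')).ne'
  have hA : ∀ j, attnWeight β q x n j = W⁻¹ * sphereWeight q √β (x j) := by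
    intro j
    rw [attnWeight]
    simp only [exp_mul_inner_eq hβ]
    rw [← Finset.mul_sum, ← hW]
    have := Real.exp_ne_zero β
    field_simp
  rw [attnDisplacement, attnOutput, ← map_sub]
  simp_rw [← map_smul, ← map_sum]
  rw [← map_smul]
  congr 1
  simp only [hA, smul_sub, Finset.sum_sub_distrib, ← Finset.sum_smul, Finset.smul_sum, smul_smul,
    ← hW, inv_mul_cancel₀ hW0, one_smul]

theorem aemeasurable_attnOutput {d : ℕ} {Ω : Type*} [MeasurableSpace Ω] {P : Measure Ω}
    {x : ℕ → Ω → USphere d} (hx : ∀ i, AEMeasurable (x i) P) (β : ℝ)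
    (V : Matrix (Fin d) (Fin d) ℝ) (q : USphere d) (n : ℕ) :
    AEMeasurable (fun ω => attnOutput β V q (fun i => x i ω) n) P := by
  have hx' : ∀ i, AEMeasurable (fun ω => (x i ω : Euc d)) P := fun i =>
    measurable_subtype_coe.comp_aemeasurable (hx i)
  have he : ∀ i, AEMeasurable (fun ω => Real.exp (β * ⟪(q : Euc d), (x i ω : Euc d)⟫)) P := fun i =>
    Real.measurable_exp.comp_aemeasurable (((hx' i).const_inner (c := (q : Euc d))).const_mul β)
  refine (Matrix.toEuclideanCLM (𝕜 := ℝ) V).continuous.measurable.comp_aemeasurable ?_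
  refine Finset.aemeasurable_fun_sum _ fun j _ => AEMeasurable.fun_smul ?_ (hx' j)
  exact (he j).div (Finset.aemeasurable_fun_sum _ fun l _ => he l)

theorem aemeasurable_attnDisplacement {d : ℕ} {Ω : Type*} [MeasurableSpace Ω] {P : Measure Ω}
    {x : ℕ → Ω → USphere d} (hx : ∀ i, AEMeasurable (x i) P) (β : ℝ)
    (V : Matrix (Fin d) (Fin d) ℝ) (q : USphere d) (n : ℕ) :
    AEMeasurable (fun ω => attnDisplacement β V q (fun i => x i ω) n) P :=
  (aemeasurable_attnOutput hx β V q n).sub_const _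

/-! ### Limit theorem for the rescaled displacement -/

section Limit

variable {m : ℕ} {Ω : Type*} [MeasurableSpace Ω] {P : Measure Ω} [IsProbabilityMeasure P]
  {q : USphere (m + 1)} {ρ : USphere (m + 1) → ℝ} {x : ℕ → Ω → USphere (m + 1)} {β : ℕ → ℝ}

/-- A weak law from the row limit theorem with mean `1` and variance `0`. The summands are at most
`1 / (n μ n)`, comparable to `√β ^ m / n`; thus `hden` says that the effective number of keys near
`q` diverges. -/
theorem tendstoInMeasure_normalized_weight_sum (hρ : Continuous ρ) (h0 : ∀ y, 0 ≤ ρ y)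
    {g : Euc (m + 1)} (hg : HasGradientAt (radialExtension ρ) g (q : Euc (m + 1)))
    (hq : 0 < ρ q) (hindep : iIndepFun x P) (hlaw : ∀ i, HasLaw (x i) (keyLaw ρ) P)
    (hβ : Tendsto β atTop atTop) (hden : Tendsto (fun n : ℕ => √(β n) ^ m / n) atTop (𝓝 0)) :
    TendstoInMeasure P (fun (n : ℕ) ω => ∑ j ∈ Finset.range n,
        sphereWeight q √(β n) (x j ω) / (n * ∫ y, sphereWeight q √(β n) y ∂keyLaw ρ)) atTop
      (fun _ => 1) := by
  have hr : Tendsto (fun n => √(β n)) atTop atTop := Real.tendsto_sqrt_atTop.comp hβ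
  obtain ⟨μ, hμdef⟩ : ∃ μ : ℕ → ℝ, ∀ n, ∫ y, sphereWeight q √(β n) y ∂keyLaw ρ = μ n :=
    ⟨_, fun _ => rfl⟩
  have hμ : Tendsto (fun n => √(β n) ^ m * μ n) atTop (𝓝 (√(2 * Real.pi) ^ m * ρ q)) := by
    simpa only [Function.comp_def, hμdef] using
      (tendsto_pow_mul_integral_keyLaw hρ h0 hg).comp hr
  have hμ2 : Tendsto (fun n => √(β n) ^ m * ∫ y, sphereWeight q √(β n) y ^ 2 ∂keyLaw ρ) atTop
      (𝓝 (√(2 * Real.pi) ^ m * ρ q / √2 ^ m)) :=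
    (tendsto_pow_mul_integral_sq_keyLaw hρ h0 hg).comp hr
  simp only [hμdef]
  have hK : 0 < √(2 * Real.pi) ^ m * ρ q := by positivity
  have hev : ∀ᶠ n : ℕ in atTop, 0 < (n : ℝ) ∧ 0 < √(β n) ∧ 0 < μ n := by
    filter_upwards [eventually_gt_atTop 0, hr.eventually_gt_atTop 0,
      hμ.eventually (lt_mem_nhds hK)] with n hn hrn hμn
    exact ⟨by exact_mod_cast hn, hrn, pos_of_mul_pos_right hμn (by positivity)⟩
  have hmeas : ∀ n : ℕ, Measurable fun y => sphereWeight q √(β n) y / (n * μ n) := fun n =>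
    (continuous_sphereWeight q _).measurable.div_const _
  have hε : Tendsto (fun n : ℕ => (n * μ n)⁻¹) atTop (𝓝 0) := by
    have h := hden.div hμ hK.ne'
    rw [zero_div] at h
    refine h.congr' ?_
    filter_upwards [hev] with n ⟨hn, hrn, hμn⟩
    simp only [Pi.div_apply]
    field_simp
  have hX : ∀ n : ℕ, AEMeasurable (fun ω => ∑ j ∈ Finset.range n,
      sphereWeight q √(β n) (x j ω) / (n * μ n)) P := fun n =>
    Finset.aemeasurable_fun_sum _ fun j _ => (hmeas n).comp_aemeasurable (hlaw j).aemeasurable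
  refine tendstoInMeasure_of_tendstoInDistribution_const (P' := P)
    (tendstoInDistribution_of_tendsto_charFun hX aemeasurable_const fun t => ?_)
  have hconst : charFun (P.map fun _ : Ω => (1 : ℝ)) t = Complex.exp ((t : ℝ) * Complex.I - (0 : ℝ) / 2) := by
    rw [Measure.map_const, measure_univ, one_smul, charFun_dirac]
    simp
  rw [hconst]
  refine tendsto_charFun_sum_of_small hindep hlaw hmeas hε ?_ ?_ ?_
  · filter_upwards [hev] with n ⟨hn, hrn, hμn⟩ y
    have hnμ : 0 < n * μ n := mul_pos hn hμn
    rw [norm_div, Real.norm_of_nonneg (sphereWeight_pos q √(β n) y).le,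
      Real.norm_of_nonneg hnμ.le, div_eq_mul_inv]
    exact mul_le_of_le_one_left (by positivity) (sphereWeight_le_one _ _ _)
  · refine tendsto_const_nhds.congr' ?_
    filter_upwards [hev] with n ⟨hn, hrn, hμn⟩
    simp only [Real.inner_apply]
    rw [integral_mul_const, integral_div, hμdef]
    field_simp
  · have h := ((hden.mul hμ2).div (hμ.pow 2) (by positivity)).mul_const (t ^ 2)
    rw [zero_mul, zero_div, zero_mul] at h
    refine h.congr' ?_
    filter_upwards [hev] with n ⟨hn, hrn, hμn⟩
    simp only [Real.inner_apply, mul_pow, div_pow, Pi.div_apply]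
    rw [integral_mul_const, integral_div]
    field_simp

/-- The rescaled displacement `c n • (ATT(n) - V q)` converges in distribution whenever its drift
and its covariance stabilise. -/
theorem tendstoInDistribution_smul_attnDisplacement (hρ : Continuous ρ) (h0 : ∀ y, 0 ≤ ρ y)
    {g : Euc (m + 1)} (hg : HasGradientAt (radialExtension ρ) g (q : Euc (m + 1)))
    (hq : 0 < ρ q) (hindep : iIndepFun x P) (hlaw : ∀ i, HasLaw (x i) (keyLaw ρ) P)
    (V : Matrix (Fin (m + 1)) (Fin (m + 1)) ℝ)
    (hβ : Tendsto β atTop atTop) (hden : Tendsto (fun n : ℕ => √(β n) ^ m / n) atTop (𝓝 0))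
    {c : ℕ → ℝ} {a b : ℝ} (hb0 : 0 ≤ b)
    (ha : Tendsto (fun n => c n / β n) atTop (𝓝 a))
    (hb : Tendsto (fun n : ℕ => c n ^ 2 * √(β n) ^ m / (n * β n)) atTop (𝓝 b)) :
    TendstoInDistribution (fun n ω => c n • attnDisplacement (β n) V q (fun i => x i ω) n) atTop
      (fun z => a • Matrix.toEuclideanCLM (𝕜 := ℝ) V (attnDrift ρ q) + z) (fun _ => P)
      (multivariateGaussian 0 (b • (V * attnCov ρ q * V.transpose))) := by
  have hr : Tendsto (fun n => √(β n)) atTop atTop := Real.tendsto_sqrt_atTop.comp hβ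
  obtain ⟨T, hT⟩ : ∃ T, Matrix.toEuclideanCLM (𝕜 := ℝ) V = T := ⟨_, rfl⟩
  obtain ⟨μ, hμdef⟩ : ∃ μ : ℕ → ℝ, ∀ n, ∫ y, sphereWeight q √(β n) y ∂keyLaw ρ = μ n :=
    ⟨_, fun _ => rfl⟩
  have hμ : Tendsto (fun n => √(β n) ^ m * μ n) atTop (𝓝 (√(2 * Real.pi) ^ m * ρ q)) := by
    simpa only [Function.comp_def, hμdef] using
      (tendsto_pow_mul_integral_keyLaw hρ h0 hg).comp hr
  have hK : 0 < √(2 * Real.pi) ^ m * ρ q := by positivity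
  have hev : ∀ᶠ n : ℕ in atTop, 0 < (n : ℝ) ∧ 0 < √(β n) ∧ 0 < μ n ∧ β n = √(β n) ^ 2 := by
    filter_upwards [eventually_gt_atTop 0, hr.eventually_gt_atTop 0,
      hμ.eventually (lt_mem_nhds hK), hβ.eventually_ge_atTop 0] with n hn hrn hμn hβn
    exact ⟨by exact_mod_cast hn, hrn, pos_of_mul_pos_right hμn (by positivity),
      (Real.sq_sqrt hβn).symm⟩
  obtain ⟨f, hf⟩ : ∃ f : ℕ → USphere (m + 1) → Euc (m + 1), f = fun n y =>
    (c n / (n * μ n) * sphereWeight q √(β n) y) • T ((y : Euc (m + 1)) - q) := ⟨_, rfl⟩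
  rw [hT]
  have hfmeas : ∀ n, Measurable (f n) := fun n => by
    have := continuous_sphereWeight q √(β n)
    rw [hf]
    exact Continuous.measurable (by fun_prop)
  -- The square of `c / (n μ √β)` is the covariance rate `hb` times the rate `hden`, divided by `(√β
  -- ^ m μ)²`.
  have hε : Tendsto (fun n : ℕ => |c n / (n * μ n * √(β n))| * ‖T‖) atTop (𝓝 0) := by
    have h := ((hb.mul hden).div (hμ.pow 2) (by positivity)).sqrt.mul_const ‖T‖
    rw [mul_zero, zero_div, Real.sqrt_zero, zero_mul] at h
    refine h.congr' ?_
    filter_upwards [hev] with n ⟨hn, hrn, hμn, hβn⟩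
    rw [← Real.sqrt_sq_eq_abs]
    congr 2
    simp only [Pi.div_apply]
    generalize √(β n) = r at *
    rw [hβn]
    field_simp
  have hsum : TendstoInDistribution (fun (n : ℕ) ω => ∑ j ∈ Finset.range n, f n (x j ω)) atTop
      (fun z => a • T (attnDrift ρ q) + z) (fun _ => P)
      (multivariateGaussian 0 (b • (V * attnCov ρ q * V.transpose))) := by
    refine tendstoInDistribution_of_tendsto_charFun (fun n =>
      Finset.aemeasurable_fun_sum _ fun j _ => (hfmeas n).comp_aemeasurable (hlaw j).aemeasurable)
      (by fun_prop) fun t => ?_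
    obtain ⟨t', ht'⟩ : ∃ t', ContinuousLinearMap.adjoint T t = t' := ⟨_, rfl⟩
    have hin : ∀ n y, ⟪f n y, t⟫ =
        c n / (n * μ n) * (sphereWeight q √(β n) y * ⟪t', (y : Euc (m + 1)) - q⟫) := by
      intro n y
      rw [hf]
      simp only
      rw [real_inner_smul_left, ← ContinuousLinearMap.adjoint_inner_right, real_inner_comm, ht']
      ring
    have hlimit : charFun ((multivariateGaussian 0 (b • (V * attnCov ρ q * V.transpose))).map
        fun z => a • T (attnDrift ρ q) + z) t =
        Complex.exp ((a * ⟪t', attnDrift ρ q⟫ : ℝ) * Complex.I -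
          ((b * (covConst (m + 1) / ρ q *
            (‖t'‖ ^ 2 - ⟪(q : Euc (m + 1)), t'⟫ ^ 2)) : ℝ) : ℂ) / 2) := by
      rw [charFun_map_const_add, charFun_multivariateGaussian (posSemidef_attnCov hq V hb0),
        dotProduct_attnCov_mulVec, ← Complex.exp_add, inner_zero_right, real_inner_smul_left,
        ← ContinuousLinearMap.adjoint_inner_right, hT, ht', real_inner_comm t' (attnDrift ρ q)]
      congr 1
      push_cast
      ring
    rw [hlimit]
    refine tendsto_charFun_sum_of_small hindep hlaw hfmeas hε ?_ ?_ ?_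
    · filter_upwards [hev] with n ⟨hn, hrn, hμn, hβn⟩ y
      have hw := sphereWeight_pos q √(β n) y
      have h1 := mul_sphereWeight_mul_norm_le q √(β n) y
      calc ‖f n y‖ = |c n / (n * μ n)| * sphereWeight q √(β n) y * ‖T ((y : Euc (m + 1)) - q)‖ := by
            rw [hf]
            simp only
            rw [norm_smul, Real.norm_eq_abs, abs_mul, abs_of_pos hw]
        _ ≤ |c n / (n * μ n)| * sphereWeight q √(β n) y * (‖T‖ * ‖(y : Euc (m + 1)) - q‖) := by
            gcongr
            exact T.le_opNorm _
        _ = |c n / (n * μ n * √(β n))| * ‖T‖ *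
            (√(β n) * (sphereWeight q √(β n) y * ‖(y : Euc (m + 1)) - q‖)) := by
            rw [abs_div, abs_div, abs_of_pos (show 0 < n * μ n by positivity),
              abs_of_pos (show 0 < n * μ n * √(β n) by positivity)]
            field_simp
        _ ≤ |c n / (n * μ n * √(β n))| * ‖T‖ * 1 := by gcongr
        _ = _ := mul_one _
    · have h := ha.mul (((tendsto_pow_mul_integral_inner_keyLaw hρ h0 hg t').comp hr).div hμ hK.ne')
      have e : a * (√(2 * Real.pi) ^ m * (⟪t', g⟫ - ρ q * ⟪t', (q : Euc (m + 1))⟫ * (m / 2)) /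
          (√(2 * Real.pi) ^ m * ρ q)) = a * ⟪t', attnDrift ρ q⟫ := by
        rw [attnDrift, sphericalGradient_log hg hq, inner_sub_right, real_inner_smul_right,
          real_inner_smul_right]
        have : √(2 * Real.pi) ^ m ≠ 0 := by positivity
        push_cast
        field_simp
        ring
      rw [e] at h
      refine h.congr' ?_
      filter_upwards [hev] with n ⟨hn, hrn, hμn, hβn⟩
      simp only [hin, integral_const_mul, Pi.div_apply, Function.comp]
      generalize √(β n) = r at *
      rw [hβn]
      field_simp
    · have h := hb.mul (((tendsto_pow_mul_integral_sq_mul_inner_sq_keyLaw hρ h0 hg t').comp hr).div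
        (hμ.pow 2) (by positivity))
      have e : b * (√(2 * Real.pi) ^ m * (ρ q * (‖t'‖ ^ 2 - ⟪(q : Euc (m + 1)), t'⟫ ^ 2)) /
          (√2 ^ m * 2) / (√(2 * Real.pi) ^ m * ρ q) ^ 2) =
          b * (covConst (m + 1) / ρ q * (‖t'‖ ^ 2 - ⟪(q : Euc (m + 1)), t'⟫ ^ 2)) := by
        rw [covConst_succ]
        have : √(2 * Real.pi) ^ m ≠ 0 := by positivity
        have : √2 ^ m ≠ 0 := by positivity
        field_simp
      rw [e] at h
      refine h.congr' ?_
      filter_upwards [hev] with n ⟨hn, hrn, hμn, hβn⟩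
      simp only [hin, mul_pow, integral_const_mul, Pi.div_apply, Function.comp]
      generalize √(β n) = r at *
      rw [hβn]
      field_simp
  -- Slutsky: the numerator converges in distribution, and the inverse of the normalised denominator
  -- tends to `1` in probability.
  have hD := tendstoInMeasure_inv_one
    (tendstoInMeasure_normalized_weight_sum hρ h0 hg hq hindep hlaw hβ hden)
  have hslutsky := hsum.continuous_comp_prodMk_of_tendstoInMeasure_const
    (g := fun z : Euc (m + 1) × ℝ => z.2 • z.1) (by fun_prop) hD (fun n => by
      refine AEMeasurable.inv (Finset.aemeasurable_fun_sum _ fun j _ => ?_)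
      exact ((continuous_sphereWeight q _).measurable.div_const _).comp_aemeasurable
        (hlaw j).aemeasurable)
  simp only [one_smul, hμdef] at hslutsky
  refine tendstoInDistribution_congr_eventually hslutsky
    (fun n => AEMeasurable.fun_const_smul
      (aemeasurable_attnDisplacement (fun i => (hlaw i).aemeasurable) _ _ _ _) _) ?_
  filter_upwards [hev, hβ.eventually_ge_atTop 0] with n ⟨hn, hrn, hμn, _⟩ hβn
  funext ω
  rw [attnDisplacement_eq hβn V q _ (by exact_mod_cast hn), ← Finset.sum_div]
  simp only [hf, mul_smul, hT]
  rw [← Finset.smul_sum, smul_smul, smul_smul]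
  congr 1
  rw [inv_div]
  have : (n : ℝ) * μ n ≠ 0 := by positivity
  field_simp

/-- The rescaled displacement converges in probability when its covariance vanishes. -/
theorem tendstoInMeasure_smul_attnDisplacement (hρ : Continuous ρ) (h0 : ∀ y, 0 ≤ ρ y)
    {g : Euc (m + 1)} (hg : HasGradientAt (radialExtension ρ) g (q : Euc (m + 1)))
    (hq : 0 < ρ q) (hindep : iIndepFun x P) (hlaw : ∀ i, HasLaw (x i) (keyLaw ρ) P)
    (V : Matrix (Fin (m + 1)) (Fin (m + 1)) ℝ)
    (hβ : Tendsto β atTop atTop) (hden : Tendsto (fun n : ℕ => √(β n) ^ m / n) atTop (𝓝 0))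
    {c : ℕ → ℝ} {a : ℝ} (ha : Tendsto (fun n => c n / β n) atTop (𝓝 a))
    (hb : Tendsto (fun n : ℕ => c n ^ 2 * √(β n) ^ m / (n * β n)) atTop (𝓝 0)) :
    TendstoInMeasure P (fun n ω => c n • attnDisplacement (β n) V q (fun i => x i ω) n) atTop
      (fun _ => a • Matrix.toEuclideanCLM (𝕜 := ℝ) V (attnDrift ρ q)) := by
  have h := tendstoInDistribution_smul_attnDisplacement hρ h0 hg hq hindep hlaw V hβ hden le_rfl
    ha hb
  -- With zero covariance the Gaussian is a point mass, so the limit is constant and convergence in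
  -- probability follows.
  have hdirac : multivariateGaussian (0 : Euc (m + 1))
      ((0 : ℝ) • (V * attnCov ρ q * V.transpose)) = Measure.dirac 0 := by
    simp [multivariateGaussian]
  refine tendstoInMeasure_of_tendstoInDistribution_const (h.congr (fun _ => ae_eq_refl _) ?_)
  rw [hdirac, EventuallyEq, ae_dirac_eq, eventually_pure, add_zero]

end Limit

/-! ### Rates -/

/-- Since `1 / α = m / 2`, raising the two quantities that define the regimes to this power yields
the rates of the limit theorem. -/
theorem sqrt_pow_div_eq_rpow {m : ℕ} (hm : 1 ≤ m) {α : ℝ} (hα : α = alphaExp (m + 1)) {b : ℝ}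
    (hb : 0 < b) {n : ℕ} (hn : 0 < n) :
    √b ^ m / n = (b * (n : ℝ) ^ (-α)) ^ ((m : ℝ) / 2) ∧
      b * (√b ^ m / n) = (b ^ (1 + α) * (n : ℝ) ^ (-α)) ^ ((m : ℝ) / 2) := by
  have hm0 : (m : ℝ) ≠ 0 := by positivity
  have hn0 : (0 : ℝ) < n := by exact_mod_cast hn
  have hα' : α = 2 / m := by rw [hα, alphaExp]; push_cast; ring
  have h1 : √b ^ m = b ^ ((m : ℝ) / 2) := by
    rw [Real.sqrt_eq_rpow, ← Real.rpow_natCast, ← Real.rpow_mul hb.le]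
    congr 1; ring
  have h2 : ((n : ℝ) ^ (-α)) ^ ((m : ℝ) / 2) = (n : ℝ)⁻¹ := by
    rw [← Real.rpow_mul hn0.le, ← Real.rpow_neg_one, hα']
    congr 1; field_simp
  constructor
  · rw [Real.mul_rpow hb.le (by positivity), h2, h1, div_eq_mul_inv]
  · rw [Real.mul_rpow (by positivity) (by positivity), h2, h1, ← Real.rpow_mul hb.le,
      show (1 + α) * ((m : ℝ) / 2) = 1 + (m : ℝ) / 2 by rw [hα']; field_simp; ring,
      Real.rpow_add hb, Real.rpow_one, div_eq_mul_inv, mul_assoc]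

/-- The ambient dimension is `d = m + 1 ≥ 2`. -/
theorem theorem4p3 {m : ℕ} (hm : 1 ≤ m)
    {Ω : Type*} [MeasurableSpace Ω] (P : Measure Ω) [IsProbabilityMeasure P]
    (q : USphere (m + 1))
    (ρ : USphere (m + 1) → ℝ) (hρ_nonneg : ∀ y, 0 ≤ ρ y)
    (hρ_smooth : ContMDiff (𝓡 m) 𝓘(ℝ, ℝ) 2 ρ) (hρ_pos : 0 < ρ q)
    (x : ℕ → Ω → USphere (m + 1))
    (hx_indep : iIndepFun x P) (hx_law : ∀ i, HasLaw (x i) (keyLaw ρ) P)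
    (V : Matrix (Fin (m + 1)) (Fin (m + 1)) ℝ)
    (α : ℝ) (hα : α = alphaExp (m + 1))
    (β : ℕ → ℝ) (hβ : Tendsto β atTop atTop)
    (hβ_sub : Tendsto (fun n : ℕ => β n * (n : ℝ) ^ (-α)) atTop (𝓝 0)) :
    -- drift dominated
    (Tendsto (fun n : ℕ => β n ^ (1 + α) * (n : ℝ) ^ (-α)) atTop (𝓝 0) →
      TendstoInMeasure P
        (fun n ω => β n • attnDisplacement (β n) V q (fun i => x i ω) n) atTop
        (fun _ => Matrix.toEuclideanCLM (𝕜 := ℝ) V (attnDrift ρ q))) ∧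
    -- mixed drift and fluctuation
    (∀ τ : ℝ, 0 < τ →
      Tendsto (fun n : ℕ => β n ^ (1 + α) * (n : ℝ) ^ (-α)) atTop (𝓝 τ) →
      TendstoInDistribution
        (fun n ω => β n • attnDisplacement (β n) V q (fun i => x i ω) n) atTop
        (fun g => Matrix.toEuclideanCLM (𝕜 := ℝ) V (attnDrift ρ q) + g)
        (fun _ => P)
        (multivariateGaussian 0 (τ ^ (1 / α) • (V * attnCov ρ q * V.transpose)))) ∧
    -- fluctuation dominated
    (Tendsto (fun n : ℕ => β n ^ (1 + α) * (n : ℝ) ^ (-α)) atTop atTop →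
      TendstoInDistribution
        (fun n ω => Real.sqrt (n * β n ^ (-1 / α + 1)) •
          attnDisplacement (β n) V q (fun i => x i ω) n) atTop
        (fun g => g) (fun _ => P)
        (multivariateGaussian 0 (V * attnCov ρ q * V.transpose))) ∧
    -- consistency, in every regime
    TendstoInMeasure P (fun n ω => attnDisplacement (β n) V q (fun i => x i ω) n) atTop
      (fun _ => 0) ∧
    TendstoInMeasure P (fun n ω => attnOutput (β n) V q (fun i => x i ω) n) atTop
      (fun _ => Matrix.toEuclideanCLM (𝕜 := ℝ) V (q : Euc (m + 1))) := by
  have hα1 : 1 / α = (m : ℝ) / 2 := by rw [hα, alphaExp]; push_cast; simp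
  have hm2 : (0 : ℝ) < (m : ℝ) / 2 := by positivity
  have hρ := hρ_smooth.continuous
  have hg := (differentiableAt_radialExtension hρ_smooth q).hasGradientAt
  have hev : ∀ᶠ n : ℕ in atTop, 0 < n ∧ 0 < β n :=
    (eventually_gt_atTop 0).and (hβ.eventually_gt_atTop 0)
  have hden : Tendsto (fun n : ℕ => √(β n) ^ m / n) atTop (𝓝 0) := by
    have h := hβ_sub.rpow_const (p := (m : ℝ) / 2) (Or.inr hm2.le)
    rw [Real.zero_rpow hm2.ne'] at h
    refine h.congr' ?_
    filter_upwards [hev] with n ⟨hn, hb⟩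
    exact (sqrt_pow_div_eq_rpow hm hα hb hn).1.symm
  have hone : Tendsto (fun n => β n / β n) atTop (𝓝 1) := by
    refine tendsto_const_nhds.congr' ?_
    filter_upwards [hev] with n ⟨hn, hb⟩
    exact (div_self hb.ne').symm
  have hsq : ∀ τ : ℝ, Tendsto (fun n : ℕ => β n ^ (1 + α) * (n : ℝ) ^ (-α)) atTop (𝓝 τ) →
      Tendsto (fun n : ℕ => β n ^ 2 * √(β n) ^ m / (n * β n)) atTop (𝓝 (τ ^ ((m : ℝ) / 2))) := by
    intro τ hτ
    refine (hτ.rpow_const (p := (m : ℝ) / 2) (Or.inr hm2.le)).congr' ?_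
    filter_upwards [hev] with n ⟨hn, hb⟩
    rw [← (sqrt_pow_div_eq_rpow hm hα hb hn).2]
    have hn0 : (0 : ℝ) < n := by exact_mod_cast hn
    field_simp
  -- The scale `c = 1` makes both the drift and the covariance vanish.
  have hconsistent : TendstoInMeasure P
      (fun n ω => attnDisplacement (β n) V q (fun i => x i ω) n) atTop (fun _ => 0) := by
    have h1 : Tendsto (fun n => (1 : ℝ) / β n) atTop (𝓝 0) := hβ.const_div_atTop 1
    have h2 : Tendsto (fun n : ℕ => (1 : ℝ) ^ 2 * √(β n) ^ m / (n * β n)) atTop (𝓝 0) := by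
      have h := hden.mul h1
      rw [zero_mul] at h
      refine h.congr fun n => ?_
      rw [div_mul_div_comm]
      ring
    simpa using tendstoInMeasure_smul_attnDisplacement hρ hρ_nonneg hg hρ_pos hx_indep hx_law V
      hβ hden (c := fun _ => 1) h1 h2
  refine ⟨fun h => ?_, fun τ hτ h => ?_, fun h => ?_, hconsistent, ?_⟩
  · have hb := hsq 0 h
    rw [Real.zero_rpow hm2.ne'] at hb
    simpa using tendstoInMeasure_smul_attnDisplacement hρ hρ_nonneg hg hρ_pos hx_indep hx_law V
      hβ hden hone hb
  · rw [hα1]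
    have hlim := tendstoInDistribution_smul_attnDisplacement hρ hρ_nonneg hg hρ_pos hx_indep
      hx_law V hβ hden (Real.rpow_nonneg hτ.le _) hone (hsq τ h)
    simpa only [one_smul] using hlim
  -- The scale is the one that makes the covariance rate exactly `1`.
  · have hc2 : ∀ᶠ n : ℕ in atTop, √(n * β n ^ (-1 / α + 1)) ^ 2 * √(β n) ^ m = n * β n := by
      filter_upwards [hev] with n ⟨hn, hb⟩
      rw [Real.sq_sqrt (by positivity), show -1 / α + 1 = 1 - (m : ℝ) / 2 by rw [← hα1]; ring,
        Real.rpow_sub hb, Real.rpow_one, Real.sqrt_eq_rpow, ← Real.rpow_natCast (β n ^ (1 / 2 : ℝ)),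
        ← Real.rpow_mul hb.le, show 1 / 2 * (m : ℝ) = m / 2 by ring]
      have : β n ^ ((m : ℝ) / 2) ≠ 0 := (Real.rpow_pos_of_pos hb _).ne'
      field_simp
    have hb : Tendsto (fun n : ℕ => √(n * β n ^ (-1 / α + 1)) ^ 2 * √(β n) ^ m / (n * β n)) atTop
        (𝓝 1) := by
      refine tendsto_const_nhds.congr' ?_
      filter_upwards [hev, hc2] with n ⟨hn, hb⟩ hc
      have hn0 : (0 : ℝ) < n := by exact_mod_cast hn
      rw [hc, div_self (by positivity)]
    -- The square of `c / β` is the inverse of `(β ^ (1 + α) n ^ (-α)) ^ (m / 2)`, which diverges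
    -- here, so the drift disappears.
    have ha : Tendsto (fun n : ℕ => √(n * β n ^ (-1 / α + 1)) / β n) atTop (𝓝 0) := by
      have h1 := (((tendsto_rpow_atTop hm2).comp h).inv_tendsto_atTop).sqrt
      rw [Real.sqrt_zero] at h1
      refine h1.congr' ?_
      filter_upwards [hev, hc2] with n ⟨hn, hb⟩ hc
      have hn0 : (0 : ℝ) < n := by exact_mod_cast hn
      have hs : 0 < √(β n) := Real.sqrt_pos.mpr hb
      simp only [Pi.inv_apply, Function.comp]
      rw [← (sqrt_pow_div_eq_rpow hm hα hb hn).2]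
      have hc0 : 0 ≤ √(n * β n ^ (-1 / α + 1)) / β n := by positivity
      rw [← Real.sqrt_sq hc0, div_pow]
      congr 1
      have hsm : √(β n) ^ m ≠ 0 := by positivity
      rw [eq_div_of_mul_eq hsm hc]
      field_simp
    have hlim := tendstoInDistribution_smul_attnDisplacement hρ hρ_nonneg hg hρ_pos hx_indep
      hx_law V hβ hden zero_le_one ha hb
    simpa only [one_smul, zero_smul, zero_add] using hlim
  · intro ε hε
    simpa [attnDisplacement, edist_eq_enorm_sub] using hconsistent ε hε
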